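/- Let $K$ be a field and $A$ an alphabet (a set), and let $A^*$ be the set of words over $A$. Write $\mathrm{Vec}$ for the category of $K$-vector spaces and $\mathrm{VecFin}$ for its full subcategory of finite-dimensional spaces. **Gluings.** Let $G\colon E\to\mathrm{Vec}$ be a diagram indexed by a small category. For a vector space $X$ let $\widehat G(X)$ be the set of all linear maps $g\colon X\to G(e)$, $e\in E$, modulo the least equivalence relation that identifies $g\colon X\to G(e)$ with $G(j)\circ g\colon X\to G(e')$ for every arrow $j\colon e\to e'$ of $E$. A morphism from $F\colon D\to\mathrm{Vec}$ to $G$ assigns to each $d\in D$ a class $f(d)\in\widehat G(F(d))$ such that, for every $u\colon d\to d'$ in $D$ and every $g\in f(d')$, one has $g\circ F(u)\in f(d)$; morphisms are composed through representatives. $\mathrm{Glue}(\mathrm{Vec})$ is the category of those diagrams that have a cocone all of whose components are monomorphisms. $\mathrm{GlueFin}(\mathrm{VecFin})$ is its full subcategory on the diagrams whose index category has finitely many objects and arrows and whose values are finite-dimensional. $\mathrm{Vec}$ embeds in $\mathrm{Glue}(\mathrm{Vec})$ by one-object, one-arrow diagrams. **Automata.** Let $I,F$ be objects of a category $\mathcal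 C$. A $\mathcal C$-language is a map $L\colon A^*\to\mathcal C(I,F)$. A $\mathcal C$-automaton consists of an object $Q$ (the state object) and morphisms $i\colon I\to Q$, $f\colon Q\to F$ and $\delta_a\colon Q\to Q$ for $a\in A$. It accepts $L$ if $L(a_1\cdots a_n)=f\circ\delta_{a_n}\circ\cdots\circ\delta_{a_1}\circ i$ for all words. Automata for $L$ form a category, whose morphisms are the $\mathcal C$-morphisms of state objects that commute with $i$, $f$ and all $\delta_a$. For a full subcategory $\mathcal S$ of $\mathcal C$ containing $I$ and $F$, an $\mathcal S$-automaton is one whose state object is in $\mathcal S$. **Minimality.** A morphism $e\colon X\to T$ of $\mathcal C$ with $T\in\mathcal S$ is an $\mathcal S$-extremal epimorphism if, whenever $e=m\circ g$ with $m$ a monomorphism of $\mathcal C$ whose domain is in $\mathcal S$, $m$ is an isomorphism. An $\mathcal S$-automaton $N$ for $L$ is minimal if the category of $\mathcal C$-automata for $L$ has an initial object $X$ and a final object $Y$, and the unique morphism $X\to Y$ factors as $X\to N\to Y$, where the $\mathcal C$-morphism underlying $X\to N$ is an $\mathcal S$-extremal epimorphism and the one underlying $N\to Y$ is a monomorphism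 of $\mathcal C$. **Statement.** Take $\mathcal C=\mathrm{Glue}(\mathrm{Vec})$ and $\mathcal S=\mathrm{GlueFin}(\mathrm{VecFin})$. 1. For all $I,F\in\mathrm{GlueFin}(\mathrm{VecFin})$, every $\mathrm{Glue}(\mathrm{Vec})$-language $L\colon A^*\to\mathrm{Glue}(\mathrm{Vec})(I,F)$ accepted by some $\mathrm{GlueFin}(\mathrm{VecFin})$-automaton has a minimal $\mathrm{GlueFin}(\mathrm{VecFin})$-automaton, and it is unique up to isomorphism of automata. 2. In particular, for all finite-dimensional vector spaces $I,F$ (for example $I=F=K$), every $\mathrm{Vec}$-language $L\colon A^*\to\mathrm{Vec}(I,F)$ accepted by an automaton in $\mathrm{Vec}$ with finite-dimensional state space has, when regarded as a $\mathrm{Glue}(\mathrm{Vec})$-language through the embedding, a minimal $\mathrm{GlueFin}(\mathrm{VecFin})$-automaton, unique up to isomorphism of automata. -/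

import Mathlib

open CategoryTheory CategoryTheory.Limits

universe v u

namespace HybridAutomata

section Automata

variable {C : Type u} [Category.{v} C]

/-- An automaton in the category `C` over the alphabet `A`, with input object `I` and output
object `F`. -/
structure Automaton (A : Type v) (I F : C) where
  /-- the state object -/
  Q : C
  /-- the initial morphism -/
  initMap : I ⟶ Q
  /-- the final morphism -/
  finalMap : Q ⟶ F
  /-- the transition morphisms -/
  δ : A → (Q ⟶ Q)

namespace Automaton

variable {A : Type v} {I F : C}

/-- The extension of the transition morphisms to words, read from left to right. -/
def run (M : Automaton A I F) : List A → (M.Q ⟶ M.Q)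
  | [] => 𝟙 M.Q
  | a :: w => M.δ a ≫ M.run w

theorem run_append (M : Automaton A I F) (w w' : List A) :
    M.run (w ++ w') = M.run w ≫ M.run w' := by
  induction w with
  | nil => simp [run]
  | cons a w ih => simp [run, ih]

theorem run_concat (M : Automaton A I F) (w : List A) (a : A) :
    M.run (w ++ [a]) = M.run w ≫ M.δ a := by
  simp [run_append, run]

/-- `M` accepts the language `L : A* → C(I, F)`. -/
def Accepts (L : List A → (I ⟶ F)) (M : Automaton A I F) : Prop :=
  ∀ w : List A, M.initMap ≫ M.run w ≫ M.finalMap = L w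

/-- Morphisms of automata. -/
@[ext]
structure Hom (M N : Automaton A I F) where
  /-- the underlying morphism between the state objects -/
  h : M.Q ⟶ N.Q
  init_comm : M.initMap ≫ h = N.initMap
  δ_comm : ∀ a : A, M.δ a ≫ h = h ≫ N.δ a
  final_comm : h ≫ N.finalMap = M.finalMap

instance : Category (Automaton A I F) where
  Hom M N := Hom M N
  id M := ⟨𝟙 _, by simp, by simp, by simp⟩
  comp f g := ⟨f.h ≫ g.h, by rw [← Category.assoc, f.init_comm, g.init_comm],
    fun a => by rw [← Category.assoc, f.δ_comm, Category.assoc, g.δ_comm, Category.assoc],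
    by rw [Category.assoc, g.final_comm, f.final_comm]⟩
  id_comp f := Hom.ext (Category.id_comp f.h)
  comp_id f := Hom.ext (Category.comp_id f.h)
  assoc f g k := Hom.ext (Category.assoc f.h g.h k.h)

end Automaton

/-- The category of automata in `C` accepting the language `L`. -/
abbrev Auto {A : Type v} {I F : C} (L : List A → (I ⟶ F)) :=
  ObjectProperty.FullSubcategory
    (fun M : Automaton A I F => M.Accepts L)

/-- The morphism of `C` underlying a morphism of automata for `L`. -/
def Auto.homMap {A : Type v} {I F : C} {L : List A → (I ⟶ F)} {M N : Auto L} (f : M ⟶ N) :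
    M.obj.Q ⟶ N.obj.Q :=
  Automaton.Hom.h f.hom

/-- For the full subcategory of `C` on the objects satisfying `S`: the `S`-extremal epimorphisms,
with respect to the class of monomorphisms of `C`. They need not be epimorphisms of `C`. -/
def IsExtremalEpi (S : ObjectProperty C) {X T : C} (e : X ⟶ T) : Prop :=
  S T ∧ ∀ ⦃U : C⦄ (g : X ⟶ U) (m : U ⟶ T), S U → Mono m → g ≫ m = e → IsIso m

/-- For the full subcategory of `C` on the objects satisfying `S`: the monomorphisms of `C` with
domain in `S`. -/
def IsMonoFrom (S : ObjectProperty C) {T Y : C} (m : T ⟶ Y) : Prop :=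
  S T ∧ Mono m

/-- `M` is a minimal `S`-automaton for `L`: it is an `S`-automaton for `L` obtained by factorizing
the unique morphism from an initial to a final automaton in the category of all automata in `C`
for `L` as an `S`-extremal epimorphism followed by a monomorphism with domain in `S`. -/
def IsMinimal (S : ObjectProperty C) {A : Type v} {I F : C} (L : List A → (I ⟶ F))
    (M : Auto L) : Prop :=
  S M.obj.Q ∧ ∃ X Y : Auto L, Nonempty (IsInitial X) ∧ Nonempty (IsTerminal Y) ∧
    ∃ (e : X ⟶ M) (m : M ⟶ Y),
      IsExtremalEpi S (Auto.homMap e) ∧ IsMonoFrom S (Auto.homMap m)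

end Automata

section Gluing

/-- Small diagrams in `C`. -/
structure Diag (C : Type u) [Category.{v} C] where
  /-- the index category -/
  Ix : Type v
  [cat : SmallCategory Ix]
  /-- the functor -/
  fn : Ix ⥤ C

attribute [instance] Diag.cat

variable {C : Type u} [Category.{v} C]

namespace Diag

/-- The relation which generates the equivalence on arrows from `X` to objects in the image of
`G`. -/
def Rel (G : Diag C) (X : C) (p q : Σ e : G.Ix, X ⟶ G.fn.obj e) : Prop :=
  ∃ j : p.1 ⟶ q.1, p.2 ≫ G.fn.map j = q.2

/-- Classes of arrows from `X` to objects in the image of `G`, modulo the least equivalence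
relation containing `Rel`. -/
def Hat (G : Diag C) (X : C) : Type v := Quot (G.Rel X)

/-- The class of an arrow. -/
def cls (G : Diag C) {X : C} (e : G.Ix) (g : X ⟶ G.fn.obj e) : G.Hat X :=
  Quot.mk _ ⟨e, g⟩

theorem cls_map (G : Diag C) {X : C} {e e' : G.Ix} (g : X ⟶ G.fn.obj e) (j : e ⟶ e') :
    G.cls e' (g ≫ G.fn.map j) = G.cls e g :=
  (Quot.sound ⟨j, rfl⟩).symm

/-- Precomposition acts on classes. -/
def Hat.pre {G : Diag C} {X X' : C} (k : X' ⟶ X) : G.Hat X → G.Hat X' :=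
  Quot.lift (fun p => G.cls p.1 (k ≫ p.2)) (by
    rintro ⟨e, g⟩ ⟨e', g'⟩ ⟨j, hj⟩
    change g ≫ G.fn.map j = g' at hj
    change G.cls e (k ≫ g) = G.cls e' (k ≫ g')
    rw [← hj, ← Category.assoc]
    exact (G.cls_map (k ≫ g) j).symm)

@[simp] theorem Hat.pre_cls {G : Diag C} {X X' : C} (k : X' ⟶ X) (e : G.Ix)
    (g : X ⟶ G.fn.obj e) : Hat.pre k (G.cls e g) = G.cls e (k ≫ g) := rfl

theorem Hat.ind {G : Diag C} {X : C} {P : G.Hat X → Prop}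
    (h : ∀ e g, P (G.cls e g)) (x : G.Hat X) : P x :=
  Quot.ind (fun p => h p.1 p.2) x

theorem Hat.pre_id {G : Diag C} {X : C} (x : G.Hat X) : Hat.pre (𝟙 X) x = x := by
  induction x using Hat.ind with | h e g => simp

theorem Hat.pre_comp {G : Diag C} {X X' X'' : C} (l : X'' ⟶ X') (k : X' ⟶ X) (x : G.Hat X) :
    Hat.pre (l ≫ k) x = Hat.pre l (Hat.pre k x) := by
  induction x using Hat.ind with | h e g => simp

/-- Morphisms of diagrams: a class for each object of the index category of the source, compatible
with precomposition by the arrows of the source diagram. -/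
@[ext]
structure Hom (F G : Diag C) where
  /-- the class at an index -/
  app : ∀ d : F.Ix, G.Hat (F.fn.obj d)
  compat : ∀ ⦃d d' : F.Ix⦄ (j : d ⟶ d'), Hat.pre (F.fn.map j) (app d') = app d

/-- A morphism of diagrams acts on classes by postcomposition (with representatives). -/
def Hom.push {F G : Diag C} (f : Hom F G) {X : C} : F.Hat X → G.Hat X :=
  Quot.lift (fun p => Hat.pre p.2 (f.app p.1)) (by
    rintro ⟨e, g⟩ ⟨e', g'⟩ ⟨j, hj⟩
    dsimp at hj ⊢
    rw [← hj, Hat.pre_comp, f.compat])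

@[simp] theorem Hom.push_cls {F G : Diag C} (f : Hom F G) {X : C} (d : F.Ix)
    (g : X ⟶ F.fn.obj d) : f.push (F.cls d g) = Hat.pre g (f.app d) := rfl

theorem Hom.push_pre {F G : Diag C} (f : Hom F G) {X X' : C} (k : X' ⟶ X) (x : F.Hat X) :
    f.push (Hat.pre k x) = Hat.pre k (f.push x) := by
  induction x using Hat.ind with | h e g => simp [Hat.pre_comp]

/-- The identity morphism of a diagram. -/
def Hom.id (F : Diag C) : Hom F F where
  app d := F.cls d (𝟙 _)
  compat d d' j := by
    have h := F.cls_map (𝟙 (F.fn.obj d)) j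
    simpa using h

/-- Composition of morphisms of diagrams. -/
def Hom.comp {F G H : Diag C} (f : Hom F G) (g : Hom G H) : Hom F H where
  app d := g.push (f.app d)
  compat d d' j := by rw [← Hom.push_pre, f.compat]

theorem Hom.push_id {F : Diag C} {X : C} (x : F.Hat X) : (Hom.id F).push x = x := by
  induction x using Hat.ind with | h e g => simp [Hom.id]

theorem Hom.push_comp {F G H : Diag C} (f : Hom F G) (g : Hom G H) {X : C} (x : F.Hat X) :
    (f.comp g).push x = g.push (f.push x) := by
  induction x using Hat.ind with | h e k => simp [Hom.comp, Hom.push_pre]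

/-- The free colimit completion of `C`. -/
instance : Category (Diag C) where
  Hom := Hom
  id := Hom.id
  comp := Hom.comp
  id_comp f := Hom.ext (funext fun d => by
    exact Hat.pre_id (f.app d))
  comp_id f := Hom.ext (funext fun d => Hom.push_id _)
  assoc f g h := Hom.ext (funext fun d => (Hom.push_comp g h _).symm)

/-- Diagrams which have a cocone all of whose components are monomorphisms. -/
def IsMonoDiagram : ObjectProperty (Diag C) := fun F =>
  ∃ c : Cocone F.fn, ∀ d, Mono (c.ι.app d)

/-- The diagram with one object and one (identity) arrow. -/
def single (V : C) : Diag C where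
  Ix := Discrete PUnit
  fn := Functor.fromPUnit V

/-- Morphisms between one-object diagrams. -/
def singleMap {V W : C} (f : V ⟶ W) : Hom (single V) (single W) where
  app _ := (single W).cls (X := V) ⟨PUnit.unit⟩ f
  compat _ _ _ := congrArg ((single W).cls (X := V) ⟨PUnit.unit⟩) (Category.id_comp f)

theorem isMonoDiagram_single (V : C) : IsMonoDiagram (single V) :=
  ⟨⟨V, ⟨fun _ => 𝟙 V, fun _ _ _ => rfl⟩⟩, fun _ => inferInstanceAs (Mono (𝟙 V))⟩

end Diag

/-- The glued category of `C`. -/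
abbrev Glue (C : Type u) [Category.{v} C] := ObjectProperty.FullSubcategory (Diag.IsMonoDiagram (C := C))

/-- The embedding of `C` into its glued category, by one-object diagrams. -/
def Glue.embed (C : Type u) [Category.{v} C] : C ⥤ Glue C where
  obj V := ⟨Diag.single V, Diag.isMonoDiagram_single V⟩
  map f := ObjectProperty.homMk (Diag.singleMap f)
  map_id _ := rfl
  map_comp _ _ := rfl

end Gluing

/-- The objects of the full subcategory of finite gluings of finite-dimensional vector spaces:
finite index category (finitely many objects and arrows), finite-dimensional values. -/
def GlueFinVecFin (K : Type u) [Field K] : ObjectProperty (Glue (ModuleCat.{u} K)) := fun G =>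
  Finite G.obj.Ix ∧ (∀ d d' : G.obj.Ix, Finite (d ⟶ d')) ∧
    ∀ d : G.obj.Ix, FiniteDimensional K (G.obj.fn.obj d)

end HybridAutomata

/-! A gluing `G` is determined by its presheaf of classes `Hat`: morphisms of gluings are natural
maps, and monomorphisms are the injective ones. A monic cocone sends each class over `X` to a linear
map from `X` to a fixed space, and restrictions of a class along two maps agree as soon as these
linear maps do. Conversely, any presheaf with this property (`GluedPresheaf`) comes from a gluing of
subspaces (`realize`). Copowers, powers and subpresheaves can therefore be formed on presheaves:
words paired with inputs give the initial automaton, families of outputs indexed by words give the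
final one, and subpresheaves of the latter that are closed under shifts and contain the reachable
states give automata.

The minimal automaton is the intersection of all finitely generated subpresheaves of the final one
that contain the reachable states. That it is again finitely generated is a Noetherian argument. In
a finite gluing, two elements over a finite-dimensional space agree exactly on a finite union of
subspaces (`finAgree_ofGlue`). This passes to powers, and it makes membership in a finitely
generated subpresheaf a condition of the same kind (`FG.finDetermined`). Arbitrary intersections of
finite unions of subspaces are again finite unions (`FinSieve.forall`), so cutting a finitely
generated subpresheaf by any family of such conditions keeps it finitely generated (`FG.inter`).
Finally, `FG.exists_realization` turns a finitely generated subpresheaf into a finite gluing, by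
adjoining to the generators the subspaces on which they agree pairwise. -/

namespace HybridAutomata

/-! ### Gluings as presheaves of classes. -/

namespace Diag

variable {C : Type u} [Category.{v} C]

/-- A natural family of maps between classes is induced by a morphism of diagrams. -/
def Hom.ofNatural {F G : Diag C} (t : ∀ X : C, F.Hat X → G.Hat X)
    (ht : ∀ ⦃X X' : C⦄ (k : X' ⟶ X) (x : F.Hat X), t X' (Hat.pre k x) = Hat.pre k (t X x)) :
    Hom F G where
  app d := t _ (F.cls d (𝟙 _))
  compat d d' j := by
    rw [← ht, Hat.pre_cls, Category.comp_id]
    have h := F.cls_map (𝟙 (F.fn.obj d)) j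
    rw [Category.id_comp] at h
    rw [h]

theorem Hom.push_ofNatural {F G : Diag C} (t : ∀ X : C, F.Hat X → G.Hat X)
    (ht : ∀ ⦃X X' : C⦄ (k : X' ⟶ X) (x : F.Hat X), t X' (Hat.pre k x) = Hat.pre k (t X x))
    {X : C} (x : F.Hat X) : (Hom.ofNatural t ht).push x = t X x := by
  induction x using Hat.ind with
  | h e g => rw [Hom.push_cls, ofNatural, ← ht, Hat.pre_cls, Category.comp_id]

end Diag

namespace Glue

variable {C : Type u} [Category.{v} C]

/-- The action of a morphism of gluings on classes. -/
def act {G H : Glue C} (f : G ⟶ H) {X : C} (x : G.obj.Hat X) : H.obj.Hat X :=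
  Diag.Hom.push (F := G.obj) (G := H.obj) f.hom x

theorem act_pre {G H : Glue C} (f : G ⟶ H) {X X' : C} (k : X' ⟶ X) (x : G.obj.Hat X) :
    act f (Diag.Hat.pre k x) = Diag.Hat.pre k (act f x) :=
  Diag.Hom.push_pre _ k x

@[simp] theorem act_id (G : Glue C) {X : C} (x : G.obj.Hat X) : act (𝟙 G) x = x :=
  Diag.Hom.push_id x

@[simp] theorem act_comp {G H J : Glue C} (f : G ⟶ H) (g : H ⟶ J) {X : C} (x : G.obj.Hat X) :
    act (f ≫ g) x = act g (act f x) :=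
  Diag.Hom.push_comp _ _ x

theorem hom_ext_act {G H : Glue C} {f g : G ⟶ H}
    (h : ∀ (X : C) (x : G.obj.Hat X), act f x = act g x) : f = g := by
  apply ObjectProperty.hom_ext
  refine Diag.Hom.ext (funext fun d => ?_)
  have := h _ (G.obj.cls d (𝟙 _))
  simpa [act, Diag.Hat.pre_id] using this

/-- A natural family of maps between classes is the action of a morphism of gluings. -/
def homOfNatural {G H : Glue C} (t : ∀ X : C, G.obj.Hat X → H.obj.Hat X)
    (ht : ∀ ⦃X X' : C⦄ (k : X' ⟶ X) (x : G.obj.Hat X),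
      t X' (Diag.Hat.pre k x) = Diag.Hat.pre k (t X x)) : G ⟶ H :=
  ObjectProperty.homMk (Diag.Hom.ofNatural t ht)

@[simp] theorem act_homOfNatural {G H : Glue C} (t : ∀ X : C, G.obj.Hat X → H.obj.Hat X)
    (ht : ∀ ⦃X X' : C⦄ (k : X' ⟶ X) (x : G.obj.Hat X),
      t X' (Diag.Hat.pre k x) = Diag.Hat.pre k (t X x)) {X : C} (x : G.obj.Hat X) :
    act (homOfNatural t ht) x = t X x :=
  Diag.Hom.push_ofNatural t ht x

/-- The morphism from an embedded object which corresponds to a class. -/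
def ofClass {G : Glue C} {X : C} (x : G.obj.Hat X) : (embed C).obj X ⟶ G :=
  ObjectProperty.homMk (show Diag.Hom (Diag.single X) G.obj from
    { app := fun _ => x
      compat := fun _ _ _ => Diag.Hat.pre_id x })

/-- Yoneda: classes over `X` are the morphisms from the embedded object `X`, and `f` can be
cancelled against these. -/
theorem injective_act_of_mono {G H : Glue C} (f : G ⟶ H) [Mono f] (X : C) :
    Function.Injective (act f (X := X)) := by
  intro x y hxy
  have h : ofClass x ≫ f = ofClass y ≫ f := by
    apply hom_ext_act
    intro Z z
    induction z using Diag.Hat.ind with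
    | h e k =>
      rw [act_comp, act_comp]
      exact (act_pre f (show Z ⟶ X from k) x).trans
        ((congrArg _ hxy).trans (act_pre f (show Z ⟶ X from k) y).symm)
  have h' := (cancel_mono f).1 h
  have := congrArg (fun m => act m (((embed C).obj X).obj.cls (X := X) ⟨PUnit.unit⟩ (𝟙 X))) h'
  exact (Diag.Hat.pre_id x).symm.trans (this.trans (Diag.Hat.pre_id y))

theorem mono_of_injective_act {G H : Glue C} (f : G ⟶ H)
    (hf : ∀ X : C, Function.Injective (act f (X := X))) : Mono f where
  right_cancellation g h hgh := by
    apply hom_ext_act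
    intro X x
    apply hf
    rw [← act_comp, hgh, act_comp]

theorem isIso_of_bijective_act {G H : Glue C} (f : G ⟶ H)
    (hf : ∀ X : C, Function.Bijective (act f (X := X))) : IsIso f := by
  let E := fun X => Equiv.ofBijective _ (hf X)
  have hE : ∀ X (x : H.obj.Hat X), act f ((E X).symm x) = x := fun X x => (E X).apply_symm_apply x
  refine ⟨homOfNatural (fun X => (E X).symm) ?_, hom_ext_act fun X x => ?_,
    hom_ext_act fun X x => ?_⟩
  · intro X X' k x
    apply (hf X').1
    rw [act_pre, hE, hE]
  · apply (hf X).1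
    simp [hE]
  · simp [hE]

end Glue

/-! ### Presheaves over a representable, and their points. -/

/-- Presheaves of sets on vector spaces together with a map to a representable presheaf through
which restriction factors. -/
structure GluedPresheaf (K : Type u) [Field K] where
  /-- the values -/
  obj : ModuleCat.{u} K → Type u
  /-- the restriction maps -/
  res : ∀ ⦃X Y : ModuleCat.{u} K⦄, (Y ⟶ X) → obj X → obj Y
  res_id : ∀ (X : ModuleCat.{u} K) (p : obj X), res (𝟙 X) p = p
  res_comp : ∀ ⦃X Y Z : ModuleCat.{u} K⦄ (l : Z ⟶ Y) (k : Y ⟶ X) (p : obj X),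
    res (l ≫ k) p = res l (res k p)
  /-- the space to which everything maps -/
  pt : ModuleCat.{u} K
  /-- the linear map underlying an element -/
  φ : ∀ ⦃X : ModuleCat.{u} K⦄, obj X → (X ⟶ pt)
  φ_res : ∀ ⦃X Y : ModuleCat.{u} K⦄ (k : Y ⟶ X) (p : obj X), φ (res k p) = k ≫ φ p
  res_eq : ∀ ⦃X Y : ModuleCat.{u} K⦄ (p : obj X) (a b : Y ⟶ X), a ≫ φ p = b ≫ φ p →
    res a p = res b p

namespace GluedPresheaf

variable {K : Type u} [Field K]

/-- The presheaf of classes of a gluing. -/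
noncomputable def ofGlue (G : Glue (ModuleCat.{u} K)) : GluedPresheaf K where
  obj := G.obj.Hat
  res _ _ k p := Diag.Hat.pre k p
  res_id _ p := Diag.Hat.pre_id p
  res_comp _ _ _ l k p := Diag.Hat.pre_comp l k p
  pt := G.property.choose.pt
  φ X := Quot.lift (fun p => p.2 ≫ G.property.choose.ι.app p.1) (by
    rintro ⟨e, g⟩ ⟨e', g'⟩ ⟨j, hj⟩
    dsimp at hj ⊢
    rw [← hj, Category.assoc, Cocone.w])
  φ_res X Y k p := by
    induction p using Diag.Hat.ind with | h e g => exact Category.assoc _ _ _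
  res_eq X Y p a b h := by
    induction p using Diag.Hat.ind with
    | h e g =>
      have h' : a ≫ g ≫ G.property.choose.ι.app e = b ≫ g ≫ G.property.choose.ι.app e := h
      -- Only here are the components of the cocone required to be monic.
      have := G.property.choose_spec e
      rw [← Category.assoc, ← Category.assoc, cancel_mono] at h'
      rw [Diag.Hat.pre_cls, Diag.Hat.pre_cls, h']

variable (P : GluedPresheaf K)

/-- The elements over subspaces of `P.pt` whose underlying linear map is the inclusion. -/
structure Point where
  /-- the subspace -/
  U : Submodule K P.pt
  /-- the element -/
  x : P.obj (ModuleCat.of K U)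
  φ_x : P.φ x = ModuleCat.ofHom U.subtype

variable {P}

/-- The inclusion between two subspaces. -/
abbrev incl {V : ModuleCat.{u} K} {U W : Submodule K V} (h : U ≤ W) :
    ModuleCat.of K U ⟶ ModuleCat.of K W :=
  ModuleCat.ofHom (Submodule.inclusion h)

theorem incl_comp_incl {V : ModuleCat.{u} K} {U W Z : Submodule K V} (h : U ≤ W) (h' : W ≤ Z) :
    incl h ≫ incl h' = incl (h.trans h') := rfl

instance : Preorder P.Point where
  le s t := ∃ h : s.U ≤ t.U, P.res (incl h) t.x = s.x
  le_refl s := ⟨le_rfl, P.res_id _ _⟩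
  le_trans r s t := by
    rintro ⟨h, hx⟩ ⟨h', hx'⟩
    exact ⟨h.trans h', by rw [← hx, ← hx', ← P.res_comp, incl_comp_incl]⟩

theorem res_eq_of_le {s t : P.Point} (h : s ≤ t) {X : ModuleCat.{u} K}
    (k : X ⟶ ModuleCat.of K s.U) : P.res k s.x = P.res (k ≫ incl h.1) t.x := by
  rw [P.res_comp, h.2]

theorem Point.U_le {s t : P.Point} (h : s ≤ t) : s.U ≤ t.U := h.1

/-- The restriction of a point to a smaller subspace. -/
def Point.restrict (s : P.Point) (W : Submodule K P.pt) (h : W ≤ s.U) : P.Point where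
  U := W
  x := P.res (incl h) s.x
  φ_x := by rw [P.φ_res, s.φ_x]; rfl

theorem Point.restrict_le (s : P.Point) (W : Submodule K P.pt) (h : W ≤ s.U) :
    s.restrict W h ≤ s := ⟨h, rfl⟩

theorem exists_section_range {X Y : ModuleCat.{u} K} (f : X ⟶ Y) :
    ∃ (W : Submodule K Y) (e : X ⟶ ModuleCat.of K W) (s : ModuleCat.of K W ⟶ X),
      W = LinearMap.range f.hom ∧ e ≫ ModuleCat.ofHom W.subtype = f ∧
      s ≫ f = ModuleCat.ofHom W.subtype := by
  obtain ⟨s, hs⟩ := f.hom.rangeRestrict.exists_rightInverse_of_surjective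
    (LinearMap.range_rangeRestrict _)
  refine ⟨_, ModuleCat.ofHom f.hom.rangeRestrict, ModuleCat.ofHom s, rfl, rfl, ?_⟩
  ext x
  have := congrArg Subtype.val (LinearMap.congr_fun hs x)
  simpa using this

/-- Image factorization for elements: restricting `p` along a section of `X → range (P.φ p)` gives a
point, and it lies below every point from which `p` is restricted. -/
theorem exists_point {X : ModuleCat.{u} K} (p : P.obj X) :
    ∃ (r : P.Point) (e : X ⟶ ModuleCat.of K r.U), P.res e r.x = p ∧
      r.U = LinearMap.range (P.φ p).hom ∧ (∃ l : ModuleCat.of K r.U ⟶ X, P.res l p = r.x) ∧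
      ∀ (s : P.Point) (k : X ⟶ ModuleCat.of K s.U), P.res k s.x = p →
        ∃ h : r ≤ s, e ≫ incl h.1 = k := by
  obtain ⟨W, e, s, hW, he, hs⟩ := exists_section_range (P.φ p)
  refine ⟨⟨W, P.res s p, ?_⟩, e, ?_, hW, ⟨s, rfl⟩, ?_⟩
  · rw [P.φ_res, hs]
  · rw [← P.res_comp]
    -- `e ≫ s` need not be the identity, but it becomes so after `P.φ p`, which is all that `res_eq`
    -- asks.
    conv_rhs => rw [← P.res_id _ p]
    apply P.res_eq
    rw [Category.id_comp, Category.assoc]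
    exact (congrArg (e ≫ ·) hs).trans he
  · rintro t k rfl
    have hφ : P.φ (P.res k t.x) = k ≫ ModuleCat.ofHom t.U.subtype := by rw [P.φ_res, t.φ_x]
    have hm : Mono (ModuleCat.ofHom t.U.subtype) :=
      (ModuleCat.mono_iff_injective _).2 t.U.injective_subtype
    have hle : W ≤ t.U := by
      rw [hW, hφ]
      rintro _ ⟨y, rfl⟩
      exact (k.hom y).2
    refine ⟨⟨hle, ?_⟩, ?_⟩
    · change P.res (incl hle) t.x = P.res s (P.res k t.x)
      rw [← P.res_comp]
      congr 1
      rw [← cancel_mono (ModuleCat.ofHom t.U.subtype), Category.assoc, ← hφ]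
      exact hs.symm
    · rw [← cancel_mono (ModuleCat.ofHom t.U.subtype), Category.assoc]
      exact he.trans hφ

/-- The diagram of the subspaces underlying a set of points. -/
def diag (T : Set P.Point) : Diag (ModuleCat.{u} K) where
  Ix := T
  fn :=
    { obj := fun t => ModuleCat.of K t.1.U
      map := fun j => incl (Point.U_le (leOfHom j))
      map_id := fun _ => rfl
      map_comp := fun _ _ => rfl }

/-- The gluing of the subspaces underlying a set of points. -/
def glue (T : Set P.Point) : Glue (ModuleCat.{u} K) :=
  ⟨diag T, ⟨P.pt, ⟨fun t => ModuleCat.ofHom t.1.U.subtype, fun _ _ _ => rfl⟩⟩, fun t =>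
    (ModuleCat.mono_iff_injective _).2 t.1.U.injective_subtype⟩

/-- The element of `P` given by a class of the gluing of a set of points. -/
def eval (T : Set P.Point) {X : ModuleCat.{u} K} : (glue T).obj.Hat X → P.obj X :=
  Quot.lift (fun p => P.res p.2 p.1.1.x) (by
    rintro ⟨s, k⟩ ⟨t, l⟩ ⟨j, hj⟩
    have h : s.1 ≤ t.1 := leOfHom (X := T) j
    change k ≫ incl h.1 = l at hj
    subst hj
    exact res_eq_of_le h k)

theorem eval_pre (T : Set P.Point) {X Y : ModuleCat.{u} K} (k : Y ⟶ X)
    (x : (glue T).obj.Hat X) : eval T (Diag.Hat.pre k x) = P.res k (eval T x) := by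
  induction x using Diag.Hat.ind with
  | h t l => exact P.res_comp _ _ _

/-- Any two points of `T` above a common point are linked in `T` above it. -/
def Linked (T : Set P.Point) : Prop :=
  ∀ s ∈ T, ∀ s' ∈ T, ∀ r : P.Point, r ≤ s → r ≤ s' →
    ∃ s₁ ∈ T, ∃ s₁' ∈ T, ∃ t ∈ T, s ≤ s₁ ∧ s' ≤ s₁' ∧ t ≤ s₁ ∧ t ≤ s₁' ∧ r ≤ t

theorem linked_univ : Linked (Set.univ : Set P.Point) := fun s _ s' _ r h h' =>
  ⟨s, trivial, s', trivial, r, trivial, le_rfl, le_rfl, h, h', le_rfl⟩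

theorem cls_eq_of_le {T : Set P.Point} {s t : P.Point} (hs : s ∈ T) (ht : t ∈ T) (h : s ≤ t)
    {X : ModuleCat.{u} K} (k : X ⟶ ModuleCat.of K s.U) :
    (glue T).obj.cls (X := X) ⟨s, hs⟩ k = (glue T).obj.cls (X := X) ⟨t, ht⟩ (k ≫ incl h.1) :=
  ((glue T).obj.cls_map (X := X) (e := ⟨s, hs⟩) (e' := ⟨t, ht⟩) k
    (homOfLE (X := T) h)).symm

/-- Two representatives of one element both factor through its image point `r`. The link above `r`
then supplies the zigzag `s ≤ s₁ ≥ t ≤ s₁' ≥ s'` that identifies their classes. -/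
theorem eval_injective {T : Set P.Point} (hT : Linked T) {X : ModuleCat.{u} K} :
    Function.Injective (eval T (X := X)) := by
  intro x y
  induction x using Diag.Hat.ind with | h s k => ?_
  induction y using Diag.Hat.ind with | h s' k' => ?_
  intro hxy
  obtain ⟨s, hs⟩ := s
  obtain ⟨s', hs'⟩ := s'
  change P.res k s.x = P.res k' s'.x at hxy
  obtain ⟨r, e, -, -, -, hr⟩ := exists_point (P.res k s.x)
  obtain ⟨h, rfl⟩ := hr s k rfl
  obtain ⟨h', rfl⟩ := hr s' k' hxy.symm
  obtain ⟨s₁, hs₁, s₁', hs₁', t, ht, h₁, h₁', h₂, h₂', h₃⟩ := hT s hs s' hs' r h h'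
  refine (cls_eq_of_le hs hs₁ h₁ _).trans ?_
  refine Eq.trans ?_ (cls_eq_of_le hs' hs₁' h₁' _).symm
  exact (cls_eq_of_le ht hs₁ h₂ (e ≫ incl h₃.1)).symm.trans
    (cls_eq_of_le ht hs₁' h₂' (e ≫ incl h₃.1))

theorem eval_univ_surjective {X : ModuleCat.{u} K} :
    Function.Surjective (eval (Set.univ : Set P.Point) (X := X)) := by
  intro p
  obtain ⟨r, e, h, -⟩ := exists_point p
  exact ⟨(glue Set.univ).obj.cls (X := X) ⟨r, trivial⟩ e, h⟩

theorem glueFinVecFin_glue {T : Set P.Point} (hT : T.Finite)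
    (hU : ∀ t ∈ T, FiniteDimensional K t.U) : GlueFinVecFin K (glue T) := by
  refine ⟨hT.to_subtype, fun d d' => ?_, fun d => hU d.1 d.2⟩
  change Finite (ULift (PLift _))
  infer_instance

end GluedPresheaf

/-! ### Finite unions of subspaces. -/

/-- In a well-founded meet-semilattice with top, an arbitrary intersection of finitely generated
lower sets is finitely generated. -/
theorem exists_finite_forall_exists_le_iff {α : Type*} [SemilatticeInf α] [OrderTop α]
    [WellFoundedLT α] {ι : Sort*} (S : ι → Set α) (hS : ∀ i, (S i).Finite) :
    ∃ T : Set α, T.Finite ∧ ∀ x, (∀ i, ∃ a ∈ S i, x ≤ a) ↔ ∃ b ∈ T, x ≤ b := by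
  suffices h : ∀ c : α, ∃ T : Set α, T.Finite ∧
      ∀ x, (x ≤ c ∧ ∀ i, ∃ a ∈ S i, x ≤ a) ↔ ∃ b ∈ T, x ≤ b by
    simpa using h ⊤
  intro c
  induction c using WellFoundedLT.induction with | ind c ih => ?_
  by_cases hc : ∀ i, ∃ a ∈ S i, c ≤ a
  · refine ⟨{c}, Set.finite_singleton c, fun x => ?_⟩
    simp only [Set.mem_singleton_iff, exists_eq_left, and_iff_left_iff_imp]
    exact fun hx i => (hc i).imp fun a ha => ⟨ha.1, hx.trans ha.2⟩
  -- If `c` is under no element of `S i`, every `c ⊓ a` with `a ∈ S i` is strictly below `c`, and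
  -- the solutions below `c` are the union of those below these finitely many meets.
  · push Not at hc
    obtain ⟨i, hi⟩ := hc
    have key : ∀ a ∈ S i, ∃ T : Set α, T.Finite ∧
        ∀ x, (x ≤ c ⊓ a ∧ ∀ i, ∃ a ∈ S i, x ≤ a) ↔ ∃ b ∈ T, x ≤ b :=
      fun a ha => ih _ (inf_le_left.lt_of_ne fun h => hi a ha (inf_eq_left.1 h))
    choose! T hT hT' using key
    refine ⟨⋃ a ∈ S i, T a, (hS i).biUnion hT, fun x => ?_⟩
    simp only [Set.mem_iUnion, exists_prop]
    constructor
    · rintro ⟨hx, h⟩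
      obtain ⟨a, ha, hxa⟩ := h i
      obtain ⟨b, hb, hxb⟩ := (hT' a ha x).1 ⟨le_inf hx hxa, h⟩
      exact ⟨b, ⟨a, ha, hb⟩, hxb⟩
    · rintro ⟨b, ⟨a, ha, hb⟩, hxb⟩
      obtain ⟨hx, h⟩ := (hT' a ha x).2 ⟨b, hb, hxb⟩
      exact ⟨hx.trans inf_le_left, h⟩

variable {K : Type u} [Field K]

/-- The surjection of `Y` onto the range of `m` splits. Neither `m` injective nor a unique lift is
needed. -/
theorem exists_comp_eq_of_range_le {X Y Z : ModuleCat.{u} K} (m : Y ⟶ Z) (f : X ⟶ Z)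
    (h : LinearMap.range f.hom ≤ LinearMap.range m.hom) : ∃ l : X ⟶ Y, l ≫ m = f := by
  obtain ⟨s, hs⟩ := m.hom.rangeRestrict.exists_rightInverse_of_surjective
    (LinearMap.range_rangeRestrict _)
  refine ⟨ModuleCat.ofHom
    (s ∘ₗ f.hom.codRestrict (LinearMap.range m.hom) fun x => h ⟨x, rfl⟩), ?_⟩
  ext x
  exact congrArg Subtype.val (LinearMap.congr_fun hs ⟨f.hom x, h ⟨x, rfl⟩⟩)

/-- A family of maps into `U` which consists of the maps whose range is contained in one of
finitely many subspaces. -/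
def FinSieve (U : ModuleCat.{u} K) (D : ∀ X : ModuleCat.{u} K, (X ⟶ U) → Prop) : Prop :=
  ∃ S : Set (Submodule K U), S.Finite ∧
    ∀ (X : ModuleCat.{u} K) (a : X ⟶ U), D X a ↔ ∃ A ∈ S, LinearMap.range a.hom ≤ A

/-- Subspaces of `U` satisfy the descending chain condition, so the index may be infinite. This is
the Noetherian input of the whole proof. -/
theorem FinSieve.forall {U : ModuleCat.{u} K} [FiniteDimensional K U] {ι : Sort*}
    {D : ι → ∀ X : ModuleCat.{u} K, (X ⟶ U) → Prop} (h : ∀ i, FinSieve U (D i)) :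
    FinSieve U (fun X a => ∀ i, D i X a) := by
  choose S hS hS' using h
  obtain ⟨T, hT, hT'⟩ := exists_finite_forall_exists_le_iff S hS
  refine ⟨T, hT, fun X a => ?_⟩
  simp only [hS', hT']

theorem FinSieve.biExists {U : ModuleCat.{u} K} {ι : Type*} {T : Set ι} (hT : T.Finite)
    {D : ι → ∀ X : ModuleCat.{u} K, (X ⟶ U) → Prop} (h : ∀ i ∈ T, FinSieve U (D i)) :
    FinSieve U (fun X a => ∃ i ∈ T, D i X a) := by
  choose! S hS hS' using h
  refine ⟨⋃ i ∈ T, S i, hT.biUnion hS, fun X a => ?_⟩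
  simp only [Set.mem_iUnion, exists_prop]
  constructor
  · rintro ⟨i, hi, h⟩
    obtain ⟨A, hA, hle⟩ := (hS' i hi X a).1 h
    exact ⟨A, ⟨i, hi, hA⟩, hle⟩
  · rintro ⟨A, ⟨i, hi, hA⟩, hle⟩
    exact ⟨i, hi, (hS' i hi X a).2 ⟨A, hA, hle⟩⟩

/-! ### Finitely generated subpresheaves and agreement loci. -/

namespace GluedPresheaf

variable (P : GluedPresheaf K)

/-- The locus where two elements over a finite-dimensional space agree is a finite union of
subspaces. -/
def FinAgree : Prop :=
  ∀ (U : ModuleCat.{u} K), FiniteDimensional K U → ∀ p q : P.obj U,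
    FinSieve U (fun _ a => P.res a p = P.res a q)

variable {P}

/-- The locus where an element over a finite-dimensional space lies in `Q` is a finite union of
subspaces. -/
def FinDetermined (Q : ∀ X : ModuleCat.{u} K, Set (P.obj X)) : Prop :=
  ∀ (U : ModuleCat.{u} K), FiniteDimensional K U → ∀ p : P.obj U,
    FinSieve U (fun X a => P.res a p ∈ Q X)

/-- The subpresheaf `N` is generated by finitely many elements over finite-dimensional spaces. -/
def FG (N : ∀ X : ModuleCat.{u} K, Set (P.obj X)) : Prop :=
  ∃ T : Set (Σ X : ModuleCat.{u} K, P.obj X), T.Finite ∧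
    (∀ t ∈ T, FiniteDimensional K t.1) ∧
    ∀ (X : ModuleCat.{u} K) (p : P.obj X), p ∈ N X ↔ ∃ t ∈ T, ∃ k : X ⟶ t.1, P.res k t.2 = p

theorem FG.res_mem {N : ∀ X : ModuleCat.{u} K, Set (P.obj X)} (hN : FG N)
    {X Y : ModuleCat.{u} K} (k : Y ⟶ X) {p : P.obj X} (hp : p ∈ N X) : P.res k p ∈ N Y := by
  obtain ⟨T, -, -, hT⟩ := hN
  obtain ⟨t, ht, l, rfl⟩ := (hT X p).1 hp
  exact (hT Y _).2 ⟨t, ht, k ≫ l, P.res_comp _ _ _⟩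

/-- `P.res a p` is a restriction of a generator `t` along some `k` exactly when `(a, k)` lands in
the agreement locus of `p` and `t` over `U × t.1`. The sieve is the projection of that locus to `U`,
and linear images of subspaces are subspaces. -/
theorem FG.finDetermined {N : ∀ X : ModuleCat.{u} K, Set (P.obj X)} (hN : FG N)
    (hP : P.FinAgree) : FinDetermined N := by
  obtain ⟨T, hT, hfd, hN⟩ := hN
  intro U hU p
  simp only [hN]
  refine FinSieve.biExists hT fun t ht => ?_
  have := hfd t ht
  let W := ModuleCat.of K (U × t.1)
  let π₁ : W ⟶ U := ModuleCat.ofHom (LinearMap.fst K U t.1)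
  let π₂ : W ⟶ t.1 := ModuleCat.ofHom (LinearMap.snd K U t.1)
  obtain ⟨S, hS, hS'⟩ := hP W (inferInstanceAs (FiniteDimensional K (U × t.1)))
    (P.res π₁ p) (P.res π₂ t.2)
  dsimp only at hS'
  refine ⟨(fun A : Submodule K W => A.map π₁.hom) '' S, hS.image _, fun X a => ?_⟩
  simp only [Set.exists_mem_image]
  constructor
  · rintro ⟨k, hk⟩
    let b : X ⟶ W := ModuleCat.ofHom (a.hom.prod k.hom)
    have hb : b ≫ π₁ = a := rfl
    have hb' : b ≫ π₂ = k := rfl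
    obtain ⟨A, hA, hle⟩ := (hS' X b).1 (by rw [← P.res_comp, ← P.res_comp, hb, hb', hk])
    refine ⟨A, hA, ?_⟩
    rintro _ ⟨x, rfl⟩
    exact ⟨b.hom x, hle ⟨x, rfl⟩, rfl⟩
  · rintro ⟨A, hA, hle⟩
    -- Lift `a` linearly to `A`; the second coordinate of the lift is the required `k`.
    obtain ⟨l, hl⟩ := exists_comp_eq_of_range_le (ModuleCat.ofHom A.subtype ≫ π₁) a (by
      intro x hx
      obtain ⟨y, hy, rfl⟩ := hle hx
      exact ⟨⟨y, hy⟩, rfl⟩)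
    have h := (hS' X (l ≫ ModuleCat.ofHom A.subtype)).2 ⟨A, hA, by
      rintro _ ⟨x, rfl⟩
      exact (l.hom x).2⟩
    rw [← P.res_comp, ← P.res_comp, Category.assoc, hl] at h
    exact ⟨_, h.symm⟩

theorem FinDetermined.forall {ι : Sort*} {Q : ι → ∀ X : ModuleCat.{u} K, Set (P.obj X)}
    (h : ∀ i, FinDetermined (Q i)) :
    FinDetermined (P := P) (fun X => {p | ∀ i, p ∈ Q i X}) :=
  fun U hU p => FinSieve.forall fun i => h i U hU p

/-- Each generator `t` of `N` is replaced by its restrictions to the finitely many subspaces of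
`t.1` that cut out `Q`. -/
theorem FG.inter {N Q : ∀ X : ModuleCat.{u} K, Set (P.obj X)} (hN : FG N)
    (hQ : FinDetermined Q) : FG (P := P) (fun X => N X ∩ Q X) := by
  obtain ⟨T, hT, hfd, hN⟩ := hN
  choose! S hS hS' using fun t (ht : t ∈ T) => hQ t.1 (hfd t ht) t.2
  refine ⟨⋃ t ∈ T, (fun A : Submodule K t.1 =>
    (⟨ModuleCat.of K A, P.res (ModuleCat.ofHom A.subtype) t.2⟩ : Σ X, P.obj X)) '' S t,
    hT.biUnion fun t ht => (hS t ht).image _, ?_, fun X p => ?_⟩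
  · simp only [Set.mem_iUnion, Set.mem_image]
    rintro _ ⟨t, ht, A, -, rfl⟩
    have := hfd t ht
    exact inferInstanceAs (FiniteDimensional K A)
  · simp only [Set.mem_iUnion, Set.mem_image]
    constructor
    · rintro ⟨h, hq⟩
      obtain ⟨t, ht, k, rfl⟩ := (hN X p).1 h
      obtain ⟨A, hA, hle⟩ := (hS' t ht X k).1 hq
      obtain ⟨l, hl⟩ := exists_comp_eq_of_range_le (ModuleCat.ofHom A.subtype) k
        (by simpa using hle)
      exact ⟨_, ⟨t, ht, A, hA, rfl⟩, l, by rw [← P.res_comp, hl]⟩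
    · rintro ⟨_, ⟨t, ht, A, hA, rfl⟩, k, rfl⟩
      dsimp only at k ⊢
      rw [← P.res_comp]
      refine ⟨(hN X _).2 ⟨t, ht, _, rfl⟩, (hS' t ht X _).2 ⟨A, hA, ?_⟩⟩
      rintro _ ⟨x, rfl⟩
      exact (k.hom x).2

/-- The agreement locus over `s.U ⊓ s'.U`, carried into `P.pt`: it bounds the domains of the common
lower bounds of the two points. -/
theorem exists_finite_le_iff (hP : P.FinAgree) (s s' : P.Point)
    (hs : FiniteDimensional K s.U) :
    ∃ S : Set (Submodule K P.pt), S.Finite ∧ ∀ W : Submodule K P.pt,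
      (∃ A ∈ S, W ≤ A) ↔
        ∃ (h : W ≤ s.U) (h' : W ≤ s'.U), P.res (incl h) s.x = P.res (incl h') s'.x := by
  let B := s.U ⊓ s'.U
  have hB : FiniteDimensional K B := Submodule.finiteDimensional_of_le inf_le_left
  obtain ⟨S, hS, hS'⟩ := hP (ModuleCat.of K B) hB
    (P.res (incl inf_le_left) s.x) (P.res (incl inf_le_right) s'.x)
  dsimp only at hS'
  refine ⟨(fun A : Submodule K B => A.map B.subtype) '' S, hS.image _, fun W => ?_⟩
  simp only [Set.exists_mem_image]
  constructor
  · rintro ⟨A, hA, hle⟩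
    have hWB : W ≤ B := hle.trans (Submodule.map_subtype_le _ _)
    refine ⟨hWB.trans inf_le_left, hWB.trans inf_le_right, ?_⟩
    have h := (hS' _ (incl hWB)).2 ⟨A, hA, by
      rintro _ ⟨x, rfl⟩
      obtain ⟨y, hy, hxy⟩ := hle x.2
      have : y = Submodule.inclusion hWB x := Subtype.ext hxy
      exact this ▸ hy⟩
    rw [← P.res_comp, ← P.res_comp] at h
    exact h
  · rintro ⟨h, h', hx⟩
    obtain ⟨A, hA, hle⟩ := (hS' _ (incl (le_inf h h'))).1 (by
      rw [← P.res_comp, ← P.res_comp]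
      exact hx)
    exact ⟨A, hA, fun x hx => ⟨⟨x, le_inf h h' hx⟩, hle ⟨⟨x, hx⟩, rfl⟩, rfl⟩⟩

theorem Point.ext_of_le {s t t' : P.Point} (h : t ≤ s) (h' : t' ≤ s) (hU : t.U = t'.U) :
    t = t' := by
  obtain ⟨U, x, hx⟩ := t
  obtain ⟨U', x', hx'⟩ := t'
  obtain rfl : U = U' := hU
  obtain rfl : x = x' := h.2.symm.trans h'.2
  rfl

/-- `T` consists of the restrictions of the image points of the generators to the subspaces of their
pairwise agreement. A point below two members of `T` is below two image points, hence below one of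
these restrictions. -/
theorem FG.exists_linked {N : ∀ X : ModuleCat.{u} K, Set (P.obj X)} (hN : FG N)
    (hP : P.FinAgree) :
    ∃ T : Set P.Point, T.Finite ∧ (∀ t ∈ T, FiniteDimensional K t.U) ∧ Linked T ∧
      ∀ (X : ModuleCat.{u} K) (p : P.obj X),
        p ∈ N X ↔ ∃ t ∈ T, ∃ k : X ⟶ ModuleCat.of K t.U, P.res k t.x = p := by
  obtain ⟨G, hG, hfd, hN⟩ := hN
  choose pt e he hU hl _ using fun t : (Σ X : ModuleCat.{u} K, P.obj X) => exists_point t.2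
  have hfd' : ∀ s ∈ pt '' G, FiniteDimensional K s.U := by
    rintro _ ⟨t, ht, rfl⟩
    have := hfd t ht
    rw [hU t]
    infer_instance
  choose! S hS hS' using fun s (hs : s ∈ pt '' G) s' => exists_finite_le_iff hP s s' (hfd' s hs)
  have hmem : ∀ {s s' : P.Point} (_ : s ∈ pt '' G) {A : Submodule K P.pt} (_ : A ∈ S s s'),
      ∃ (h : A ≤ s.U) (h' : A ≤ s'.U), P.res (incl h) s.x = P.res (incl h') s'.x :=
    fun hs A hA => (hS' _ hs _ A).1 ⟨A, hA, le_rfl⟩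
  let T : Set P.Point := ⋃ s ∈ pt '' G, ⋃ s' ∈ pt '' G, ⋃ A ∈ S s s', {t | t ≤ s ∧ t.U = A}
  have hT : ∀ t, t ∈ T ↔ ∃ s ∈ pt '' G, ∃ s' ∈ pt '' G, ∃ A ∈ S s s', t ≤ s ∧ t.U = A := by
    intro t
    simp only [T, Set.mem_iUnion, exists_prop, Set.mem_ofPred_eq]
  have hsub : pt '' G ⊆ T := by
    intro s hs
    -- A point agrees with itself on its whole subspace, so the pair `(s, s)` contributes `s`
    -- itself.
    obtain ⟨A, hA, hle⟩ := (hS' s hs s s.U).2 ⟨le_rfl, le_rfl, rfl⟩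
    exact (hT s).2 ⟨s, hs, s, hs, A, hA, le_rfl, hle.antisymm (hmem hs hA).1⟩
  refine ⟨T, ?_, ?_, ?_, ?_⟩
  · refine (hG.image pt).biUnion fun s hs => (hG.image pt).biUnion fun s' _ =>
      (hS s hs s').biUnion fun A _ => Set.Subsingleton.finite ?_
    exact fun t ht t' ht' => Point.ext_of_le ht.1 ht'.1 (ht.2.trans ht'.2.symm)
  · intro t ht
    obtain ⟨s, hs, -, -, -, -, h, -⟩ := (hT t).1 ht
    have := hfd' s hs
    exact Submodule.finiteDimensional_of_le h.1
  · intro t ht t' ht' r hr hr'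
    obtain ⟨s, hs, -, -, -, -, h, -⟩ := (hT t).1 ht
    obtain ⟨s', hs', -, -, -, -, h', -⟩ := (hT t').1 ht'
    have hrs := hr.trans h
    have hrs' := hr'.trans h'
    obtain ⟨A, hA, hle⟩ := (hS' s hs s' r.U).2 ⟨hrs.1, hrs'.1, hrs.2.trans hrs'.2.symm⟩
    obtain ⟨hs₁, hs₁', hx⟩ := hmem hs hA
    refine ⟨s, hsub hs, s', hsub hs', s.restrict A hs₁,
      (hT _).2 ⟨s, hs, s', hs', A, hA, s.restrict_le A hs₁, rfl⟩, h, h',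
      s.restrict_le A hs₁, ⟨hs₁', hx.symm⟩, ⟨hle, ?_⟩⟩
    exact (P.res_comp _ _ _).symm.trans hrs.2
  · intro X p
    constructor
    · intro hp
      obtain ⟨t, ht, k, rfl⟩ := (hN X p).1 hp
      exact ⟨pt t, hsub ⟨t, ht, rfl⟩, k ≫ e t, by rw [P.res_comp, he]⟩
    · rintro ⟨t, ht, k, rfl⟩
      obtain ⟨_, ⟨g, hg, rfl⟩, -, -, -, -, h, -⟩ := (hT t).1 ht
      obtain ⟨l, hl⟩ := hl g
      refine (hN X _).2 ⟨g, hg, (k ≫ incl h.1) ≫ l, ?_⟩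
      rw [P.res_comp, hl, ← res_eq_of_le h]

/-- If `p` and `q` agree along `a`, a zigzag of indices joins their restrictions, and the range of
`a ≫ φ p` lies in the image of every index it meets. The same zigzag then works over the largest
subspace on which `φ p = φ q` and `φ p` lands in all those images. There is one such subspace for
each set of indices, hence finitely many. -/
theorem finAgree_ofGlue {G : Glue (ModuleCat.{u} K)} (hG : Finite G.obj.Ix) :
    (ofGlue G).FinAgree := by
  intro U hU p q
  let ι := G.property.choose.ι.app
  have hι : ∀ e, Mono (ι e) := G.property.choose_spec
  let φ : ∀ {X : ModuleCat.{u} K}, G.obj.Hat X → (X ⟶ (ofGlue G).pt) :=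
    fun x => (ofGlue G).φ x
  let A : Set G.obj.Ix → Submodule K U := fun E =>
    LinearMap.eqLocus (φ p).hom (φ q).hom ⊓
      ⨅ e ∈ E, (LinearMap.range (ι e).hom).comap (φ p).hom
  refine ⟨A '' {E | (ofGlue G).res (ModuleCat.ofHom (A E).subtype) p =
    (ofGlue G).res (ModuleCat.ofHom (A E).subtype) q}, Set.toFinite _, fun X a => ?_⟩
  simp only [Set.exists_mem_image, Set.mem_ofPred_eq]
  constructor
  · intro h
    let E : Set G.obj.Ix := {e | LinearMap.range (a ≫ φ p).hom ≤ LinearMap.range (ι e).hom}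
    have hE : a ≫ φ p = a ≫ φ q := by
      have := congrArg φ h
      exact ((ofGlue G).φ_res a p).symm.trans (this.trans ((ofGlue G).φ_res a q))
    refine ⟨E, ?_, ?_⟩
    · let i := ModuleCat.ofHom (A E).subtype
      have hiq : i ≫ φ p = i ≫ φ q := by
        ext x
        exact x.2.1
      have hiE : ∀ e ∈ E, ∃ l : ModuleCat.of K (A E) ⟶ G.obj.fn.obj e, l ≫ ι e = i ≫ φ p := by
        intro e he
        apply exists_comp_eq_of_range_le
        rintro _ ⟨x, rfl⟩
        have := x.2.2
        simp only [SetLike.mem_coe, Submodule.mem_iInf] at this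
        exact this e he
      -- `S` carries a class over `X` lying above `a ≫ φ p` to the class of the lift of `i ≫ φ p` at
      -- the same index. Compatibility with arrows of the diagram transports the zigzag from `X` to
      -- `A E`; as each `ι e` is monic, `S` takes at most one value.
      let S : G.obj.Hat X → Set (G.obj.Hat (ModuleCat.of K (A E))) :=
        Quot.lift (fun z => {y | z.2 ≫ ι z.1 = a ≫ φ p ∧
          ∃ l : ModuleCat.of K (A E) ⟶ G.obj.fn.obj z.1, l ≫ ι z.1 = i ≫ φ p ∧
            G.obj.cls z.1 l = y}) (by
          rintro ⟨e, g⟩ ⟨e', g'⟩ ⟨j, hj⟩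
          change e ⟶ e' at j
          change g ≫ G.obj.fn.map j = g' at hj
          have hw : G.obj.fn.map j ≫ ι e' = ι e := G.property.choose.w j
          subst hj
          ext y
          simp only [Set.mem_ofPred_eq, Category.assoc, hw]
          refine and_congr_right fun hg => ⟨?_, ?_⟩
          · rintro ⟨l, hl, rfl⟩
            exact ⟨l ≫ G.obj.fn.map j, by rw [Category.assoc, hw, hl], G.obj.cls_map l j⟩
          · rintro ⟨l, hl, rfl⟩
            obtain ⟨l', hl'⟩ := hiE e (by
              change LinearMap.range (a ≫ φ p).hom ≤ _
              rw [← hg]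
              rintro _ ⟨x, rfl⟩
              exact ⟨g.hom x, rfl⟩)
            refine ⟨l', hl', ?_⟩
            rw [← G.obj.cls_map l' j]
            congr 1
            rw [← cancel_mono (ι e'), Category.assoc, hw, hl', hl])
      have hmem : ∀ z : G.obj.Hat U, a ≫ φ z = a ≫ φ p → i ≫ φ z = i ≫ φ p →
          Diag.Hat.pre i z ∈ S (Diag.Hat.pre a z) := by
        intro z hz hz'
        induction z using Diag.Hat.ind with
        | h e g =>
          exact ⟨(Category.assoc _ _ _).trans hz, i ≫ g, (Category.assoc _ _ _).trans hz', rfl⟩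
      have huniq : ∀ (z : G.obj.Hat X) y y', y ∈ S z → y' ∈ S z → y = y' := by
        intro z y y'
        induction z using Diag.Hat.ind with
        | h e g =>
          rintro ⟨-, l, hl, rfl⟩ ⟨-, l', hl', rfl⟩
          congr 1
          rw [← cancel_mono (ι e)]
          exact hl.trans hl'.symm
      refine huniq (Diag.Hat.pre a p) _ _ (hmem p rfl rfl) ?_
      have : Diag.Hat.pre a p = Diag.Hat.pre a q := h
      rw [this]
      exact hmem q hE.symm hiq.symm
    · rintro _ ⟨x, rfl⟩
      refine ⟨LinearMap.congr_fun (congrArg ModuleCat.Hom.hom hE) x, ?_⟩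
      simp only [SetLike.mem_coe, Submodule.mem_iInf]
      exact fun e he => he ⟨x, rfl⟩
  · rintro ⟨E, hE, hle⟩
    obtain ⟨l, rfl⟩ := exists_comp_eq_of_range_le (ModuleCat.ofHom (A E).subtype) a
      (by simpa using hle)
    rw [(ofGlue G).res_comp, hE, ← (ofGlue G).res_comp]

end GluedPresheaf

/-! ### Realizations; powers, copowers and subpresheaves. -/

namespace GluedPresheaf

/-- A gluing whose classes are the elements of `P`. -/
structure Realization (P : GluedPresheaf K) where
  /-- the gluing -/
  G : Glue (ModuleCat.{u} K)
  /-- the identification of classes with elements -/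
  ev : ∀ X : ModuleCat.{u} K, G.obj.Hat X ≃ P.obj X
  ev_pre : ∀ ⦃X Y : ModuleCat.{u} K⦄ (k : Y ⟶ X) (x : G.obj.Hat X),
    ev Y (Diag.Hat.pre k x) = P.res k (ev X x)

/-- The canonical realization, by the diagram of all points. -/
noncomputable def realize (P : GluedPresheaf K) : Realization P where
  G := glue Set.univ
  ev _ := Equiv.ofBijective (eval Set.univ) ⟨eval_injective linked_univ, eval_univ_surjective⟩
  ev_pre _ _ k x := eval_pre _ k x

namespace Realization

variable {P : GluedPresheaf K} (R : Realization P)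

theorem ev_symm_res {X Y : ModuleCat.{u} K} (k : Y ⟶ X) (p : P.obj X) :
    (R.ev Y).symm (P.res k p) = Diag.Hat.pre k ((R.ev X).symm p) := by
  rw [Equiv.symm_apply_eq, R.ev_pre, Equiv.apply_symm_apply]

/-- Morphisms to a realization of `P` from natural families of maps to `P`. -/
def lift {H : Glue (ModuleCat.{u} K)} (t : ∀ X : ModuleCat.{u} K, H.obj.Hat X → P.obj X)
    (ht : ∀ ⦃X Y : ModuleCat.{u} K⦄ (k : Y ⟶ X) (x : H.obj.Hat X),
      t Y (Diag.Hat.pre k x) = P.res k (t X x)) : H ⟶ R.G :=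
  Glue.homOfNatural (fun X x => (R.ev X).symm (t X x)) fun X Y k x => by
    rw [ht, R.ev_symm_res]

@[simp] theorem ev_act_lift {H : Glue (ModuleCat.{u} K)}
    (t : ∀ X : ModuleCat.{u} K, H.obj.Hat X → P.obj X)
    (ht : ∀ ⦃X Y : ModuleCat.{u} K⦄ (k : Y ⟶ X) (x : H.obj.Hat X),
      t Y (Diag.Hat.pre k x) = P.res k (t X x)) {X : ModuleCat.{u} K} (x : H.obj.Hat X) :
    R.ev X (Glue.act (R.lift t ht) x) = t X x := by
  simp [lift]

/-- Morphisms from a realization of `P` from natural families of maps from `P`. -/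
def desc {H : Glue (ModuleCat.{u} K)} (t : ∀ X : ModuleCat.{u} K, P.obj X → H.obj.Hat X)
    (ht : ∀ ⦃X Y : ModuleCat.{u} K⦄ (k : Y ⟶ X) (p : P.obj X),
      t Y (P.res k p) = Diag.Hat.pre k (t X p)) : R.G ⟶ H :=
  Glue.homOfNatural (fun X x => t X (R.ev X x)) fun X Y k x => by rw [R.ev_pre, ht]

@[simp] theorem act_desc {H : Glue (ModuleCat.{u} K)}
    (t : ∀ X : ModuleCat.{u} K, P.obj X → H.obj.Hat X)
    (ht : ∀ ⦃X Y : ModuleCat.{u} K⦄ (k : Y ⟶ X) (p : P.obj X),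
      t Y (P.res k p) = Diag.Hat.pre k (t X p)) {X : ModuleCat.{u} K} (x : R.G.obj.Hat X) :
    Glue.act (R.desc t ht) x = t X (R.ev X x) := by
  simp [desc]

end Realization

/-- The power of a presheaf. -/
def pow (P : GluedPresheaf K) (ι : Type u) : GluedPresheaf K where
  obj X := ι → P.obj X
  res _ _ k p i := P.res k (p i)
  res_id X p := funext fun i => P.res_id X (p i)
  res_comp _ _ _ l k p := funext fun i => P.res_comp l k (p i)
  pt := ModuleCat.of K (ι → P.pt)
  φ _ p := ModuleCat.ofHom (LinearMap.pi fun i => (P.φ (p i)).hom)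
  φ_res _ _ k p := by
    apply ModuleCat.hom_ext
    refine LinearMap.ext fun x => funext fun i => ?_
    exact LinearMap.congr_fun (congrArg ModuleCat.Hom.hom (P.φ_res k (p i))) x
  res_eq X Y p a b h := by
    refine funext fun i => P.res_eq (p i) a b ?_
    ext x
    exact congrFun (LinearMap.congr_fun (congrArg ModuleCat.Hom.hom h) x) i

/-- Agreement is coordinatewise; `FinSieve.forall` handles the infinitely many coordinates, one for
each word in the application. -/
theorem FinAgree.pow {P : GluedPresheaf K} (hP : P.FinAgree) (ι : Type u) :
    (P.pow ι).FinAgree := by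
  intro U hU p q
  obtain ⟨S, hS, hS'⟩ := FinSieve.forall fun i => hP U hU (p i) (q i)
  exact ⟨S, hS, fun X a => funext_iff.trans (hS' X a)⟩

/-- The copower of a presheaf. -/
def copow (P : GluedPresheaf K) (ι : Type u) : GluedPresheaf K where
  obj X := ι × P.obj X
  res _ _ k p := (p.1, P.res k p.2)
  res_id X p := Prod.ext rfl (P.res_id X p.2)
  res_comp _ _ _ l k p := Prod.ext rfl (P.res_comp l k p.2)
  pt := P.pt
  φ _ p := P.φ p.2
  φ_res _ _ k p := P.φ_res k p.2
  res_eq _ _ p a b h := Prod.ext rfl (P.res_eq p.2 a b h)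

/-- Subpresheaves. -/
def sub (P : GluedPresheaf K) (N : ∀ X : ModuleCat.{u} K, Set (P.obj X))
    (hN : ∀ ⦃X Y : ModuleCat.{u} K⦄ (k : Y ⟶ X) (p : P.obj X), p ∈ N X → P.res k p ∈ N Y) :
    GluedPresheaf K where
  obj X := N X
  res _ _ k p := ⟨P.res k p.1, hN k p.1 p.2⟩
  res_id X p := Subtype.ext (P.res_id X p.1)
  res_comp _ _ _ l k p := Subtype.ext (P.res_comp l k p.1)
  pt := P.pt
  φ _ p := P.φ p.1
  φ_res _ _ k p := P.φ_res k p.1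
  res_eq _ _ p a b h := Subtype.ext (P.res_eq p.1 a b h)

/-- Finitely generated subpresheaves have finite realizations. -/
theorem FG.exists_realization {P : GluedPresheaf K} (hP : P.FinAgree)
    {N : ∀ X : ModuleCat.{u} K, Set (P.obj X)}
    (hN : ∀ ⦃X Y : ModuleCat.{u} K⦄ (k : Y ⟶ X) (p : P.obj X), p ∈ N X → P.res k p ∈ N Y)
    (h : FG N) : ∃ R : Realization (P.sub N hN), GlueFinVecFin K R.G := by
  obtain ⟨T, hT, hfd, hlink, hmem⟩ := h.exists_linked hP
  have hev : ∀ (X : ModuleCat.{u} K) (x : (glue T).obj.Hat X), eval T x ∈ N X := by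
    intro X x
    induction x using Diag.Hat.ind with
    | h t k => exact (hmem X _).2 ⟨t.1, t.2, k, rfl⟩
  refine ⟨⟨glue T, fun X => Equiv.ofBijective (fun x => (⟨eval T x, hev X x⟩ : N X)) ⟨?_, ?_⟩, ?_⟩,
    glueFinVecFin_glue hT hfd⟩
  · exact fun x y hxy => eval_injective hlink (congrArg Subtype.val hxy)
  · rintro ⟨p, hp⟩
    obtain ⟨t, ht, k, rfl⟩ := (hmem X p).1 hp
    exact ⟨(glue T).obj.cls (X := X) ⟨t, ht⟩ k, rfl⟩
  · exact fun X Y k x => Subtype.ext (eval_pre T k x)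

/-- All classes of `G` are restrictions of the classes of identities, one for each of the finitely
many indices. -/
theorem FG.range {P : GluedPresheaf K} {G : Glue (ModuleCat.{u} K)} (hG : GlueFinVecFin K G)
    (t : ∀ X : ModuleCat.{u} K, G.obj.Hat X → P.obj X)
    (ht : ∀ ⦃X Y : ModuleCat.{u} K⦄ (k : Y ⟶ X) (x : G.obj.Hat X),
      t Y (Diag.Hat.pre k x) = P.res k (t X x)) : FG (P := P) (fun X => Set.range (t X)) := by
  have := hG.1
  refine ⟨Set.range fun d => (⟨G.obj.fn.obj d, t _ (G.obj.cls d (𝟙 _))⟩ :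
    Σ X : ModuleCat.{u} K, P.obj X), Set.finite_range _, ?_, fun X p => ?_⟩
  · rintro _ ⟨d, rfl⟩
    exact hG.2.2 d
  · constructor
    · rintro ⟨x, rfl⟩
      induction x using Diag.Hat.ind with
      | h d k =>
        refine ⟨_, ⟨d, rfl⟩, k, ?_⟩
        rw [← ht, Diag.Hat.pre_cls, Category.comp_id]
    · rintro ⟨_, ⟨d, rfl⟩, k, rfl⟩
      exact ⟨_, ht _ _⟩

end GluedPresheaf

open GluedPresheaf

/-! ### Morphisms and isomorphisms of automata. -/

section Automata

variable {C : Type u} [Category.{v} C] {A : Type v} {I F : C}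

theorem Automaton.Hom.run_comm {M N : Automaton A I F} (f : Automaton.Hom M N) (w : List A) :
    M.run w ≫ f.h = f.h ≫ N.run w := by
  induction w with
  | nil => simp [Automaton.run]
  | cons a w ih =>
    simp only [Automaton.run, Category.assoc]
    rw [ih, ← Category.assoc, f.δ_comm, Category.assoc]

variable {L : List A → (I ⟶ F)}

/-- Morphisms of automata for `L`. -/
def Auto.mkHom {M N : Auto L} (f : Automaton.Hom M.obj N.obj) : M ⟶ N :=
  ObjectProperty.homMk f

@[simp] theorem Auto.homMap_mkHom {M N : Auto L} (f : Automaton.Hom M.obj N.obj) :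
    Auto.homMap (Auto.mkHom f) = f.h := rfl

theorem Auto.hom_ext {M N : Auto L} {f g : M ⟶ N} (h : Auto.homMap f = Auto.homMap g) : f = g :=
  ObjectProperty.hom_ext _ (Automaton.Hom.ext h)

@[simp] theorem Auto.homMap_id (M : Auto L) : Auto.homMap (𝟙 M) = 𝟙 _ := rfl

@[simp] theorem Auto.homMap_comp {M N P : Auto L} (f : M ⟶ N) (g : N ⟶ P) :
    Auto.homMap (f ≫ g) = Auto.homMap f ≫ Auto.homMap g := rfl

theorem Auto.isIso_of_isIso_homMap {M N : Auto L} (f : M ⟶ N) [IsIso (Auto.homMap f)] :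
    IsIso f := by
  have h₁ : M.obj.initMap ≫ Auto.homMap f = N.obj.initMap := Automaton.Hom.init_comm f.hom
  have h₂ : ∀ a, M.obj.δ a ≫ Auto.homMap f = Auto.homMap f ≫ N.obj.δ a :=
    Automaton.Hom.δ_comm f.hom
  have h₃ : Auto.homMap f ≫ N.obj.finalMap = M.obj.finalMap := Automaton.Hom.final_comm f.hom
  refine ⟨Auto.mkHom ⟨inv (Auto.homMap f), ?_, fun a => ?_, ?_⟩, Auto.hom_ext ?_, Auto.hom_ext ?_⟩
  · rw [← h₁, Category.assoc, IsIso.hom_inv_id, Category.comp_id]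
  · rw [IsIso.comp_inv_eq, Category.assoc, h₂, IsIso.inv_hom_id_assoc]
  · rw [← h₃, IsIso.inv_hom_id_assoc]
  · simp
  · simp

theorem Auto.isIso_homMap {M N : Auto L} (f : M ⟶ N) [IsIso f] : IsIso (Auto.homMap f) :=
  ⟨Auto.homMap (inv f), by rw [← Auto.homMap_comp, IsIso.hom_inv_id, Auto.homMap_id],
    by rw [← Auto.homMap_comp, IsIso.inv_hom_id, Auto.homMap_id]⟩

end Automata

/-! ### Observations, residual automata and the final automaton. -/

section Observation

variable {A : Type u} {I F : Glue (ModuleCat.{u} K)}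

/-- The presheaf of the final automaton. -/
noncomputable abbrev outputs (A : Type u) (F : Glue (ModuleCat.{u} K)) : GluedPresheaf K :=
  (ofGlue F).pow (List A)

/-- The outputs which can be observed from a state, for all words. -/
def Automaton.obs (M : Automaton A I F) (X : ModuleCat.{u} K) (q : M.Q.obj.Hat X) :
    (outputs A F).obj X :=
  fun w => Glue.act (M.run w ≫ M.finalMap) q

namespace Automaton

theorem obs_pre (M : Automaton A I F) ⦃X Y : ModuleCat.{u} K⦄ (k : Y ⟶ X) (q : M.Q.obj.Hat X) :
    M.obs Y (Diag.Hat.pre k q) = (outputs A F).res k (M.obs X q) :=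
  funext fun _ => Glue.act_pre _ k q

theorem obs_nil (M : Automaton A I F) {X : ModuleCat.{u} K} (q : M.Q.obj.Hat X) :
    M.obs X q [] = Glue.act M.finalMap q := by
  simp only [obs, run, Category.id_comp]
  rfl

theorem obs_δ (M : Automaton A I F) {X : ModuleCat.{u} K} (q : M.Q.obj.Hat X) (a : A)
    (w : List A) : M.obs X (Glue.act (M.δ a) q) w = M.obs X q (a :: w) := by
  simp only [obs, run, Category.assoc, Glue.act_comp]
  rfl

theorem obs_hom {M N : Automaton A I F} (f : Automaton.Hom M N) {X : ModuleCat.{u} K}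
    (q : M.Q.obj.Hat X) : N.obs X (Glue.act f.h q) = M.obs X q := by
  funext w
  rw [obs, ← Glue.act_comp, ← Category.assoc, ← f.run_comm, Category.assoc, f.final_comm, obs]

/-- A morphism which preserves observations is a morphism of automata if states of the target are
determined by observations. -/
def homOfObs {M N : Automaton A I F} {L : List A → (I ⟶ F)} (hM : M.Accepts L)
    (hN : N.Accepts L) (hinj : ∀ X, Function.Injective (N.obs X)) (f : M.Q ⟶ N.Q)
    (hf : ∀ (X : ModuleCat.{u} K) (q : M.Q.obj.Hat X), N.obs X (Glue.act f q) = M.obs X q) :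
    Automaton.Hom M N where
  h := f
  init_comm := Glue.hom_ext_act fun X x => hinj X <| by
    rw [Glue.act_comp, hf]
    funext w
    simp only [obs, ← Glue.act_comp]
    rw [hM, hN]
  δ_comm a := Glue.hom_ext_act fun X x => hinj X <| by
    rw [Glue.act_comp, Glue.act_comp, hf]
    funext w
    rw [obs_δ, obs_δ, hf]
  final_comm := Glue.hom_ext_act fun X x => by
    rw [Glue.act_comp, ← obs_nil, ← obs_nil, hf]

end Automaton

variable (L : List A → (I ⟶ F))

/-- The observations from the states reached by a word. -/
def reach {X : ModuleCat.{u} K} (w : List A) (p : I.obj.Hat X) : (outputs A F).obj X :=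
  fun v => Glue.act (L (w ++ v)) p

theorem reach_pre {X Y : ModuleCat.{u} K} (k : Y ⟶ X) (w : List A) (p : I.obj.Hat X) :
    reach L w (Diag.Hat.pre k p) = (outputs A F).res k (reach L w p) :=
  funext fun v => Glue.act_pre (L (w ++ v)) k p

theorem reach_append_singleton {X : ModuleCat.{u} K} (w : List A) (a : A) (p : I.obj.Hat X) :
    reach L (w ++ [a]) p = fun v => reach L w p (a :: v) := by
  funext v
  simp only [reach, List.append_assoc, List.singleton_append]
  rfl

variable {L}

theorem Automaton.obs_run (M : Automaton A I F) (hM : M.Accepts L) {X : ModuleCat.{u} K}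
    (w : List A) (p : I.obj.Hat X) :
    M.obs X (Glue.act (M.initMap ≫ M.run w) p) = reach L w p := by
  funext v
  rw [obs, ← Glue.act_comp, reach, ← hM, run_append]
  simp only [Category.assoc]
  rfl

variable (L)

/-- Subpresheaves of the presheaf of the final automaton which are closed under transitions and
contain the reachable states. -/
structure Residual where
  /-- the elements -/
  carrier : ∀ X : ModuleCat.{u} K, Set ((outputs A F).obj X)
  res_mem : ∀ ⦃X Y : ModuleCat.{u} K⦄ (k : Y ⟶ X) (y : (outputs A F).obj X),
    y ∈ carrier X → (outputs A F).res k y ∈ carrier Y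
  shift_mem : ∀ {X : ModuleCat.{u} K} (y : (outputs A F).obj X) (a : A), y ∈ carrier X →
    (fun v => y (a :: v)) ∈ carrier X
  reach_mem : ∀ {X : ModuleCat.{u} K} (w : List A) (p : I.obj.Hat X), reach L w p ∈ carrier X

namespace Residual

variable {L} (N : Residual L)

/-- The underlying presheaf. -/
noncomputable abbrev psh : GluedPresheaf K := (outputs A F).sub N.carrier N.res_mem

variable {N} (R : Realization N.psh)

theorem shift_pre (a : A) {X Y : ModuleCat.{u} K} (k : Y ⟶ X) (q : R.G.obj.Hat X) :
    (⟨fun v => (R.ev Y (Diag.Hat.pre k q)).1 (a :: v), N.shift_mem _ a (R.ev Y _).2⟩ :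
      N.carrier Y) =
    N.psh.res k ⟨fun v => (R.ev X q).1 (a :: v), N.shift_mem _ a (R.ev X q).2⟩ := by
  apply Subtype.ext
  simp only [R.ev_pre]
  rfl

/-- The automaton of residual languages. -/
noncomputable def automaton : Automaton A I F where
  Q := R.G
  initMap := R.lift (fun _ p => ⟨reach L [] p, N.reach_mem [] p⟩) fun _ _ k p =>
    Subtype.ext (reach_pre L k [] p)
  finalMap := R.desc (fun _ y => y.1 []) fun _ _ _ _ => rfl
  δ a := R.lift (fun X q => ⟨fun v => (R.ev X q).1 (a :: v), N.shift_mem _ a (R.ev X q).2⟩)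
    fun _ _ k q => shift_pre R a k q

theorem ev_act_initMap {X : ModuleCat.{u} K} (p : I.obj.Hat X) :
    (R.ev X (Glue.act (automaton R).initMap p)).1 = reach L [] p :=
  congrArg Subtype.val (R.ev_act_lift _ (fun _ _ k p => Subtype.ext (reach_pre L k [] p)) p)

theorem ev_act_δ {X : ModuleCat.{u} K} (a : A) (q : R.G.obj.Hat X) :
    (R.ev X (Glue.act ((automaton R).δ a) q)).1 = fun v => (R.ev X q).1 (a :: v) :=
  congrArg Subtype.val (R.ev_act_lift _ (fun _ _ k q => shift_pre R a k q) q)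

theorem act_finalMap {X : ModuleCat.{u} K} (q : R.G.obj.Hat X) :
    Glue.act (automaton R).finalMap q = (R.ev X q).1 [] :=
  R.act_desc _ _ q

/-- Transitions shift and the final map evaluates at the empty word, so a state observes exactly the
family of outputs that it is. -/
theorem obs_automaton {X : ModuleCat.{u} K} (q : (automaton R).Q.obj.Hat X) :
    (automaton R).obs X q = (R.ev X q).1 := by
  funext w
  induction w generalizing q with
  | nil => exact (Automaton.obs_nil _ q).trans (act_finalMap R q)
  | cons a w ih =>
    exact (Automaton.obs_δ _ q a w).symm.trans ((ih _).trans (congrFun (ev_act_δ R a q) w))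

theorem obs_automaton_injective (X : ModuleCat.{u} K) :
    Function.Injective ((automaton R).obs X) := by
  intro q q' h
  rw [obs_automaton, obs_automaton] at h
  exact (R.ev X).injective (Subtype.ext h)

theorem accepts_automaton : (automaton R).Accepts L := by
  intro w
  apply Glue.hom_ext_act
  intro X p
  rw [Glue.act_comp]
  change (automaton R).obs X (Glue.act (automaton R).initMap p) w = _
  rw [obs_automaton, ev_act_initMap]
  rfl

/-- The automaton of residual languages, as an automaton for `L`. -/
noncomputable def auto : Auto L := ⟨automaton R, accepts_automaton R⟩

variable (L) in
/-- All elements. -/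
def top : Residual L where
  carrier _ := Set.univ
  res_mem _ _ _ _ _ := trivial
  shift_mem _ _ _ := trivial
  reach_mem _ _ := trivial

/-- The automaton of all outputs is terminal. -/
noncomputable def isTerminalTop (R : Realization (top L).psh) : IsTerminal (auto R) :=
  IsTerminal.ofUniqueHom
    (fun M => Auto.mkHom (Automaton.homOfObs M.property (accepts_automaton R)
      (obs_automaton_injective R)
      (R.lift (fun X q => ⟨M.obj.obs X q, trivial⟩) fun _ _ k q =>
        Subtype.ext (M.obj.obs_pre k q))
      (fun _ q => (obs_automaton R _).trans (congrArg Subtype.val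
        (R.ev_act_lift _ (fun _ _ k q => Subtype.ext (M.obj.obs_pre k q)) q)))))
    (fun _ f => Auto.hom_ext (Glue.hom_ext_act fun X q => obs_automaton_injective R X
      ((Automaton.obs_hom f.hom q).trans (Automaton.obs_hom _ q).symm)))

/-- The least subpresheaf among the finitely generated ones which contain the reachable states. -/
def least (hF : GlueFinVecFin K F) : Residual L where
  carrier X := {y | ∀ (M : ∀ X : ModuleCat.{u} K, Set ((outputs A F).obj X)) (_ : FG M)
    (_ : ∀ (X : ModuleCat.{u} K) (w : List A) (p : I.obj.Hat X), reach L w p ∈ M X), y ∈ M X}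
  res_mem _ _ k y hy M hM hr := hM.res_mem k (hy M hM hr)
  shift_mem y a hy M hM hr := by
    -- `M` need not be closed under shifts, but `M ∩ Q`, with `Q` the preimage of `M` under the
    -- shift, is another competitor in the intersection, so `y` lies in it.
    let Q : ∀ X : ModuleCat.{u} K, Set ((outputs A F).obj X) := fun X =>
      {y | (fun v => y (a :: v)) ∈ M X}
    have hQ : FinDetermined (P := outputs A F) Q := fun U hU p =>
      hM.finDetermined ((finAgree_ofGlue hF.1).pow _) U hU fun v => p (a :: v)
    refine (hy _ (hM.inter hQ) fun X w p => ⟨hr X w p, ?_⟩).2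
    change (fun v => reach L w p (a :: v)) ∈ M X
    rw [← reach_append_singleton]
    exact hr X (w ++ [a]) p
  reach_mem w p _ _ hr := hr _ w p

/-- One competitor `M` suffices: the least subpresheaf is `M` cut by the membership conditions of
all competitors, and together these are still finitely determined. -/
theorem fg_least (hF : GlueFinVecFin K F)
    {M : ∀ X : ModuleCat.{u} K, Set ((outputs A F).obj X)} (hM : FG M)
    (hr : ∀ (X : ModuleCat.{u} K) (w : List A) (p : I.obj.Hat X), reach L w p ∈ M X) :
    FG (least (L := L) hF).carrier := by
  have h := hM.inter (Q := (least (L := L) hF).carrier)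
    (FinDetermined.forall fun M => FinDetermined.forall fun hM : FG M =>
      FinDetermined.forall fun _ => hM.finDetermined ((finAgree_ofGlue hF.1).pow _))
  have heq : (fun X => M X ∩ (least (L := L) hF).carrier X) = (least (L := L) hF).carrier :=
    funext fun X => Set.inter_eq_right.2 fun y hy => hy M hM hr
  rwa [heq] at h

end Residual

/-! ### The initial automaton. -/

/-- The presheaf of the initial automaton. -/
noncomputable abbrev inputs (A : Type u) (I : Glue (ModuleCat.{u} K)) : GluedPresheaf K :=
  (ofGlue I).copow (List A)

theorem inputs_append_pre (a : A) {X Y : ModuleCat.{u} K} (k : Y ⟶ X)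
    (q : (inputs A I).realize.G.obj.Hat X) :
    (((inputs A I).realize.ev Y (Diag.Hat.pre k q)).1 ++ [a],
      ((inputs A I).realize.ev Y (Diag.Hat.pre k q)).2) =
    (inputs A I).res k
      (((inputs A I).realize.ev X q).1 ++ [a], ((inputs A I).realize.ev X q).2) := by
  rw [Realization.ev_pre]
  rfl

/-- The initial automaton, whose states are pairs of a word and an input. -/
noncomputable def freeAutomaton : Automaton A I F where
  Q := (inputs A I).realize.G
  initMap := (inputs A I).realize.lift (fun _ p => ([], p)) fun _ _ _ _ => rfl
  finalMap := (inputs A I).realize.desc (fun _ y => Glue.act (L y.1) y.2) fun _ _ k y =>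
    Glue.act_pre (L y.1) k y.2
  δ a := (inputs A I).realize.lift
    (fun X q => (((inputs A I).realize.ev X q).1 ++ [a], ((inputs A I).realize.ev X q).2))
    fun _ _ k q => inputs_append_pre a k q

theorem ev_freeAutomaton_run {X : ModuleCat.{u} K} (w : List A) (p : I.obj.Hat X) :
    (inputs A I).realize.ev X
      (Glue.act ((freeAutomaton L).initMap ≫ (freeAutomaton L).run w) p) = (w, p) := by
  induction w using List.reverseRecOn with
  | nil =>
    rw [Automaton.run, Category.comp_id]
    exact Realization.ev_act_lift _ _ (fun _ _ _ _ => rfl) p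
  | append_singleton w a ih =>
    rw [Automaton.run_concat, ← Category.assoc, Glue.act_comp]
    refine (Realization.ev_act_lift _ _ (fun _ _ k q => inputs_append_pre a k q) _).trans ?_
    rw [ih]
    rfl

theorem accepts_freeAutomaton : (freeAutomaton L).Accepts L := by
  intro w
  apply Glue.hom_ext_act
  intro X p
  rw [← Category.assoc, Glue.act_comp]
  refine (Realization.act_desc _ _ _ _).trans ?_
  rw [ev_freeAutomaton_run]

theorem exists_run_freeAutomaton {X : ModuleCat.{u} K} (q : (freeAutomaton L).Q.obj.Hat X) :
    ∃ w p, Glue.act ((freeAutomaton L).initMap ≫ (freeAutomaton L).run w) p = q :=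
  ⟨_, _, ((inputs A I).realize.ev X).injective (ev_freeAutomaton_run L _ _)⟩

/-- The initial automaton, as an automaton for `L`. -/
noncomputable def freeAuto : Auto L := ⟨freeAutomaton L, accepts_freeAutomaton L⟩

/-- The map from the initial automaton to another one. -/
noncomputable def freeAutomatonHom (M : Automaton A I F) (hM : M.Accepts L) :
    Automaton.Hom (freeAutomaton L) M := by
  let h : (freeAutomaton L).Q ⟶ M.Q := (inputs A I).realize.desc
    (fun _ y => Glue.act (M.initMap ≫ M.run y.1) y.2) fun _ _ k y => Glue.act_pre _ k y.2
  have hh : ∀ {X : ModuleCat.{u} K} (w : List A) (p : I.obj.Hat X),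
      Glue.act h (Glue.act ((freeAutomaton L).initMap ≫ (freeAutomaton L).run w) p) =
        Glue.act (M.initMap ≫ M.run w) p := by
    intro X w p
    refine (Realization.act_desc _ _ _ _).trans ?_
    rw [ev_freeAutomaton_run]
  refine ⟨h, ?_, fun a => ?_, ?_⟩
  · refine Glue.hom_ext_act fun X p => ?_
    simpa [Automaton.run] using hh [] p
  · refine Glue.hom_ext_act fun X q => ?_
    obtain ⟨w, p, rfl⟩ := exists_run_freeAutomaton L q
    have := hh (w ++ [a]) p
    rw [Automaton.run_concat, Automaton.run_concat] at this
    simp only [Glue.act_comp] at this hh ⊢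
    rw [this, hh]
  · refine Glue.hom_ext_act fun X q => ?_
    obtain ⟨w, p, rfl⟩ := exists_run_freeAutomaton L q
    rw [Glue.act_comp, hh, ← Glue.act_comp, ← Glue.act_comp, Category.assoc, Category.assoc, hM,
      accepts_freeAutomaton]

theorem Automaton.Hom.act_run {M N : Automaton A I F} (f : Automaton.Hom M N)
    {X : ModuleCat.{u} K} (w : List A) (p : I.obj.Hat X) :
    Glue.act f.h (Glue.act (M.initMap ≫ M.run w) p) = Glue.act (N.initMap ≫ N.run w) p := by
  rw [← Glue.act_comp, Category.assoc, f.run_comm, ← Category.assoc, f.init_comm]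

/-- The free automaton is initial. -/
noncomputable def isInitialFreeAuto : IsInitial (freeAuto L) :=
  IsInitial.ofUniqueHom (fun M => Auto.mkHom (freeAutomatonHom L M.obj M.property))
    (fun M f => Auto.hom_ext (Glue.hom_ext_act fun X q => by
      obtain ⟨w, p, rfl⟩ := exists_run_freeAutomaton L q
      exact (Automaton.Hom.act_run f.hom w p).trans
        (Automaton.Hom.act_run (freeAutomatonHom L M.obj M.property) w p).symm))

/-! ### Minimality and uniqueness. -/

variable {L}

/-- When the map from the initial automaton factors through a finite subobject `U`, the observations
of `U` form a finitely generated subpresheaf containing the reachable states. By leastness they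
exhaust the states. -/
theorem Residual.isMinimal_least (hF : GlueFinVecFin K F)
    (R : Realization (least (L := L) hF).psh) (hR : GlueFinVecFin K R.G) :
    IsMinimal (GlueFinVecFin K) L (auto R) := by
  refine ⟨hR, freeAuto L, auto (top L).psh.realize, ⟨isInitialFreeAuto L⟩, ⟨isTerminalTop _⟩,
    (isInitialFreeAuto L).to _, (isTerminalTop _).from _, ⟨hR, ?_⟩, hR, ?_⟩
  · intro U g m hU hm hgm
    apply Glue.isIso_of_bijective_act
    intro X
    refine ⟨Glue.injective_act_of_mono m X, fun q => ?_⟩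
    let t : ∀ X : ModuleCat.{u} K, U.obj.Hat X → (outputs A F).obj X := fun X x =>
      (automaton R).obs X (Glue.act m x)
    have ht : FG (P := outputs A F) (fun X => Set.range (t X)) := FG.range hU t fun X Y k x => by
      simp only [t]
      rw [Glue.act_pre]
      exact Automaton.obs_pre _ k _
    obtain ⟨x, hx⟩ := (R.ev X q).2 _ ht fun X w p => by
      refine ⟨Glue.act g (Glue.act ((freeAutomaton L).initMap ≫ (freeAutomaton L).run w) p), ?_⟩
      refine (congrArg ((automaton R).obs X) ((Glue.act_comp g m _).symm.trans
        (congrArg (fun f => Glue.act f _) hgm))).trans ?_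
      exact (Automaton.obs_hom _ _).trans ((freeAutomaton L).obs_run (accepts_freeAutomaton L) w p)
    exact ⟨x, obs_automaton_injective R X (hx.trans (obs_automaton R q).symm)⟩
  · apply Glue.mono_of_injective_act
    intro X q q' h
    apply obs_automaton_injective R X
    have := congrArg ((auto (top L).psh.realize).obj.obs X) h
    exact (Automaton.obs_hom _ q).symm.trans (this.trans (Automaton.obs_hom _ q'))

/-- A minimal `N'` embeds in the final automaton with finitely generated image containing the
reachable states, so the least automaton embeds in `N'`. The map from the initial automaton to `N'`
factors through this embedding, and extremality makes it an isomorphism. -/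
theorem Residual.nonempty_iso_least (hF : GlueFinVecFin K F)
    (R : Realization (least (L := L) hF).psh) (hR : GlueFinVecFin K R.G) (N' : Auto L)
    (hN' : IsMinimal (GlueFinVecFin K) L N') : Nonempty (N' ≅ auto R) := by
  obtain ⟨hS, X', Y', ⟨hX'⟩, ⟨hY'⟩, e, m, he, -, hm⟩ := hN'
  have hinj : ∀ X, Function.Injective (N'.obj.obs X) := by
    intro X q q' h
    let i := hY'.uniqueUpToIso (isTerminalTop (L := L) (top L).psh.realize)
    have := Auto.isIso_homMap i.hom
    refine Glue.injective_act_of_mono (Auto.homMap m ≫ Auto.homMap i.hom) X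
      (obs_automaton_injective _ X ?_)
    exact (Automaton.obs_hom (m ≫ i.hom).hom q).trans
      (h.trans (Automaton.obs_hom (m ≫ i.hom).hom q').symm)
  have hrange : ∀ X (q : R.G.obj.Hat X), ∃ q', N'.obj.obs X q' = (R.ev X q).1 := fun X q =>
    (R.ev X q).2 _ (FG.range hS N'.obj.obs N'.obj.obs_pre) fun X w p =>
      ⟨_, N'.obj.obs_run N'.property w p⟩
  choose t ht using hrange
  let f : R.G ⟶ N'.obj.Q := Glue.homOfNatural t fun X Y k q => hinj Y <| by
    rw [ht, Automaton.obs_pre, ht, R.ev_pre]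
    rfl
  have hf : ∀ (X : ModuleCat.{u} K) (q : R.G.obj.Hat X),
      N'.obj.obs X (Glue.act f q) = (automaton R).obs X q := fun X q => by
    rw [Glue.act_homOfNatural, ht]
    exact (obs_automaton R q).symm
  let h : auto R ⟶ N' := Auto.mkHom
    (Automaton.homOfObs (accepts_automaton R) N'.property hinj f hf)
  have hmono : Mono (Auto.homMap h) := Glue.mono_of_injective_act _ fun X q q' hq =>
    obs_automaton_injective R X
      ((hf X q).symm.trans ((congrArg (N'.obj.obs X) hq).trans (hf X q')))
  have := he.2 (Auto.homMap (hX'.to (auto R))) (Auto.homMap h) hR hmono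
    (congrArg Auto.homMap (hX'.hom_ext (hX'.to (auto R) ≫ h) e))
  have := Auto.isIso_of_isIso_homMap h
  exact ⟨(asIso h).symm⟩

theorem exists_isMinimal (hF : GlueFinVecFin K F) (M : Automaton A I F)
    (hM : GlueFinVecFin K M.Q) (hL : M.Accepts L) :
    ∃ N : Auto L, IsMinimal (GlueFinVecFin K) L N ∧
      ∀ N' : Auto L, IsMinimal (GlueFinVecFin K) L N' → Nonempty (N' ≅ N) := by
  obtain ⟨R, hR⟩ := (Residual.fg_least (L := L) hF (FG.range hM M.obs M.obs_pre) fun X w p =>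
    ⟨_, M.obs_run hL w p⟩).exists_realization ((finAgree_ofGlue hF.1).pow _)
      (Residual.least (L := L) hF).res_mem
  exact ⟨_, Residual.isMinimal_least hF R hR, Residual.nonempty_iso_least hF R hR⟩

theorem glueFinVecFin_embed (V : ModuleCat.{u} K) (hV : FiniteDimensional K V) :
    GlueFinVecFin K ((Glue.embed (ModuleCat.{u} K)).obj V) := by
  refine ⟨inferInstanceAs (Finite (Discrete PUnit)), fun d d' => ?_, fun _ => hV⟩
  change Finite (ULift (PLift _))
  infer_instance

end Observation

/-! ### Transport of automata along a functor. -/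

section Embedding

variable {C : Type u} [Category.{v} C] {D : Type*} [Category.{v} D] {A : Type v} {I F : C}

/-- The image of an automaton under a functor. -/
def Automaton.map (M : Automaton A I F) (Φ : C ⥤ D) : Automaton A (Φ.obj I) (Φ.obj F) where
  Q := Φ.obj M.Q
  initMap := Φ.map M.initMap
  finalMap := Φ.map M.finalMap
  δ a := Φ.map (M.δ a)

theorem Automaton.run_map (M : Automaton A I F) (Φ : C ⥤ D) (w : List A) :
    (M.map Φ).run w = Φ.map (M.run w) := by
  induction w with
  | nil => exact (Φ.map_id _).symm
  | cons a w ih =>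
    rw [run, ih, run, Φ.map_comp]
    rfl

theorem Automaton.Accepts.map {M : Automaton A I F} {L : List A → (I ⟶ F)} (h : M.Accepts L)
    (Φ : C ⥤ D) : (M.map Φ).Accepts fun w => Φ.map (L w) := by
  intro w
  rw [run_map]
  refine Eq.trans ?_ (congrArg Φ.map (h w))
  rw [Φ.map_comp, Φ.map_comp]
  rfl

end Embedding

end HybridAutomata

theorem mainTheorem1 (K : Type u) [Field K] (A : Type u) :
    (∀ (I F : HybridAutomata.Glue (ModuleCat.{u} K)),
      HybridAutomata.GlueFinVecFin K I → HybridAutomata.GlueFinVecFin K F →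
      ∀ L : List A → (I ⟶ F),
        (∃ M : HybridAutomata.Automaton A I F,
          HybridAutomata.GlueFinVecFin K M.Q ∧ M.Accepts L) →
        ∃ N : HybridAutomata.Auto L,
          HybridAutomata.IsMinimal (HybridAutomata.GlueFinVecFin K) L N ∧
          ∀ N' : HybridAutomata.Auto L,
            HybridAutomata.IsMinimal (HybridAutomata.GlueFinVecFin K) L N' →
            Nonempty (N' ≅ N)) ∧
    (∀ (I F : ModuleCat.{u} K), FiniteDimensional K I → FiniteDimensional K F →
      ∀ L : List A → (I ⟶ F),
        (∃ M : HybridAutomata.Automaton A I F, FiniteDimensional K M.Q ∧ M.Accepts L) →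
        ∃ N : HybridAutomata.Auto
            (fun w => (HybridAutomata.Glue.embed (ModuleCat.{u} K)).map (L w)),
          HybridAutomata.IsMinimal (HybridAutomata.GlueFinVecFin K)
            (fun w => (HybridAutomata.Glue.embed (ModuleCat.{u} K)).map (L w)) N ∧
          ∀ N' : HybridAutomata.Auto
              (fun w => (HybridAutomata.Glue.embed (ModuleCat.{u} K)).map (L w)),
            HybridAutomata.IsMinimal (HybridAutomata.GlueFinVecFin K)
              (fun w => (HybridAutomata.Glue.embed (ModuleCat.{u} K)).map (L w)) N' →
            Nonempty (N' ≅ N)) := by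
  refine ⟨fun I F _ hF L ⟨M, hM, hL⟩ => HybridAutomata.exists_isMinimal hF M hM hL, ?_⟩
  rintro I F - hF L ⟨M, hM, hL⟩
  exact HybridAutomata.exists_isMinimal (HybridAutomata.glueFinVecFin_embed F hF)
    (M.map (HybridAutomata.Glue.embed (ModuleCat.{u} K)))
    (HybridAutomata.glueFinVecFin_embed M.Q hM) (hL.map _)
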